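/- Let $n_S,n_I,n_P\ge 0$ be integers, $n_u=n_S+n_I$, $m=3n_u+n_P$. Consider the algebraic formulation of the discretized Stokes problem with Navier--Tresca stick-slip conditions, given by the following data: a symmetric positive definite matrix $A_\kappa\in\mathbb R^{3n_u\times 3n_u}$, a matrix $B\in\mathbb R^{n_P\times 3n_u}$, a symmetric positive semidefinite matrix $E\in\mathbb R^{n_P\times n_P}$, vectors $b\in\mathbb R^{3n_u}$, $c\in\mathbb R^{n_P}$, and for each node $i=1,\dots,n_S$ of the stick-slip boundary a slip bound $g_i\ge 0$ and matrices $T^i\in\mathbb R^{2\times 3}$ (two tangents) and $N^i\in\mathbb R^{1\times 3}$ (normal) such that $Q^i=\binom{T^i}{N^i}$ is orthogonal. Write $u=(u^1,\dots,u^{n_u})$ with $u^i\in\mathbb R^3$, $x=(u,\hat p)\in\mathbb R^m$ (with $\hat p$ the negative of the pressure vector), and $$H(x)=\begin{pmatrix}A_\kappa&-B^\top\\ B&E\end{pmatrix}\begin{pmatrix}u\\ \hat p\end{pmatrix}-\begin{pmatrix}b\\ c\end{pmatrix},\qquad q(x)=\sum_{i=1}^{n_S}\bigl(g_i\|T^iu^i\|+\delta_{S^i}(u^i)\bigr),\quad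 S^i=\{v\in\mathbb R^3: N^iv=0\},$$ where $\delta_S$ is $0$ on $S$ and $+\infty$ elsewhere; $\partial q$ is the convex subdifferential. Let the index $I$ denote the blocks belonging to the velocities at the nodes $n_S+1,\dots,n_u$, and assume that the discretized Stokes problem with no-slip conditions, $$\begin{pmatrix}A_{II}&-B_I^\top\\ B_I&E\end{pmatrix}\begin{pmatrix}u_I\\ \hat p\end{pmatrix}=\begin{pmatrix}b_I\\ c\end{pmatrix},$$ has a unique solution. Let $\bar x$ be a solution of the generalized equation $0\in H(x)+\partial q(x)$. Notation. For a set-valued mapping $G:\mathbb R^m\rightrightarrows\mathbb R^m$, let $\mathcal O_G$ be the set of points of $\mathrm{gph}\,G$ at which the (Bouligand) tangent cone $T_{\mathrm{gph}\,G}$ is an $m$-dimensional subspace of $\mathbb R^m\times\mathbb R^m$. $\mathcal S G(x,y)$ is the set of all $m$-dimensional subspaces $L$ for which there are $(x_k,y_k)\in\mathcal O_G$ with $(x_k,y_k)\to(x,y)$ such that the orthogonal projections onto $T_{\mathrm{gph}\,G}(x_k,y_k)$ converge to the one onto $L$. $\mathcal S^*G(x,y)$ consists of the adjoint subspaces $L^*=\{(v^*,u^*):(u^*,-v^*)\in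 L^\perp\}$, $L\in\mathcal SG(x,y)$. $G$ is SCD semismooth* at $(x_0,y_0)\in\mathrm{gph}\,G$ if $\mathcal SG\neq\emptyset$ at all points of $\mathrm{gph}\,G$ near $(x_0,y_0)$ and for every $\varepsilon>0$ there is $\delta>0$ such that $$|\langle x^*,x-x_0\rangle-\langle y^*,y-y_0\rangle|\le\varepsilon\|(x,y)-(x_0,y_0)\|\,\|(x^*,y^*)\|$$ for all $(x,y)\in\mathrm{gph}\,G$ with $\|(x,y)-(x_0,y_0)\|\le\delta$ and all $(y^*,x^*)\in L^*\in\mathcal S^*G(x,y)$. $\mathcal M_{P,W}\partial q(x,x^*)$ is the set of pairs of symmetric $m\times m$ matrices $(P,W)$ with $P^2=P$, $W(I-P)=I-P$ and $\{(Ps,Ws):s\in\mathbb R^m\}\in\mathcal S(\partial q)(x,x^*)$. The SCD semismooth* Newton method with parameter $\lambda>0$ goes from $x^k$ to $x^{k+1}$ as follows: put $z^k=\mathrm{prox}_{\lambda q}(x^k-\lambda H(x^k))$, where $\mathrm{prox}_{\varphi}(x)=\arg\min_z\{\frac12\|z-x\|^2+\varphi(z)\}$, and $z^{*k}=(x^k-z^k)/\lambda-H(x^k)$;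 choose any $(P^k,W^k)\in\mathcal M_{P,W}\partial q(z^k,z^{*k})$; solve $(P^k\nabla H(x^k)P^k+W^k)\Delta z^k=-P^k(\nabla H(x^k)-I/\lambda)(z^k-x^k)$; and put $x^{k+1}=z^k+\Delta z^k$. Then: 1. $\partial q$ is SCD semismooth* at every point of its graph. 2. For every $(P,W)\in\mathcal M_{P,W}\partial q(\bar x,-H(\bar x))$ the matrix $P\nabla H(\bar x)P+W$ is nonsingular. 3. The method converges locally superlinearly to $\bar x$: for every $\lambda>0$ there is a neighborhood $U$ of $\bar x$ such that for every starting point $x^0\in U$ the method is well-defined (at each iterate that can be reached, the proximal point exists and is unique, $(z^k,z^{*k})\in\mathrm{gph}\,\partial q$, the set $\mathcal M_{P,W}\partial q(z^k,z^{*k})$ is nonempty, and for each of its pairs the matrix of the linear system is nonsingular), and every sequence $(x^k)$ that it generates satisfies $x^k\to\bar x$ and $\|x^{k+1}-\bar x\|=o(\|x^k-\bar x\|)$. -/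

import Mathlib

open Filter Topology

noncomputable section

namespace SCD

/-! ### Set-valued mappings, tangent cones and SC derivatives -/

/-- The Euclidean space `E × E`, with norm `‖(x, y)‖² = ‖x‖² + ‖y‖²` and the corresponding
inner product. -/
abbrev Pair (E : Type*) : Type _ := WithLp 2 (E × E)

/-- The element `(x, y)` of the Euclidean product space. -/
abbrev pair {E : Type*} (x y : E) : Pair E := WithLp.toLp 2 (x, y)

/-- The graph of a set-valued mapping. -/
def gph {E : Type*} (G : E → Set E) : Set (Pair E) := {z | z.snd ∈ G z.fst}

/-- The (Bouligand) tangent cone: the outer limit of `(A - a) / t` as `t ↓ 0`. -/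
def tangentCone {F : Type*} [NormedAddCommGroup F] [NormedSpace ℝ F] (A : Set F) (a : F) :
    Set F :=
  {v | ∃ (t : ℕ → ℝ) (w : ℕ → F), (∀ k, 0 < t k) ∧ Tendsto t atTop (𝓝 0) ∧
    Tendsto w atTop (𝓝 v) ∧ ∀ k, a + t k • w k ∈ A}

section General

variable {E : Type*} [NormedAddCommGroup E] [InnerProductSpace ℝ E] [FiniteDimensional ℝ E]

/-- The set of all `m`-dimensional subspaces of `E × E`, where `m = dim E`. -/
def Z (E : Type*) [NormedAddCommGroup E] [InnerProductSpace ℝ E] : Set (Submodule ℝ (Pair E)) :=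
  {L | Module.finrank ℝ L = Module.finrank ℝ E}

/-- The distance of two subspaces: the norm of the difference of the orthogonal projections. -/
def dZ (L₁ L₂ : Submodule ℝ (Pair E)) : ℝ := ‖L₁.starProjection - L₂.starProjection‖

/-- `L` is an `m`-dimensional subspace, and it is the tangent cone to the graph of `G` at the
point `z` of the graph; that is, `G` is graphically smooth of dimension `m` at `z`, with
tangent space `L`. -/
def IsGraphTangent (G : E → Set E) (z : Pair E) (L : Submodule ℝ (Pair E)) : Prop :=
  z ∈ gph G ∧ L ∈ Z E ∧ (L : Set (Pair E)) = tangentCone (gph G) z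

/-- The subspace containing derivative `𝒮 G (x, y)`. -/
def scDeriv (G : E → Set E) (z : Pair E) : Set (Submodule ℝ (Pair E)) :=
  {L | L ∈ Z E ∧ ∃ (zs : ℕ → Pair E) (Ls : ℕ → Submodule ℝ (Pair E)),
    (∀ k, IsGraphTangent G (zs k) (Ls k)) ∧ Tendsto zs atTop (𝓝 z) ∧
    Tendsto (fun k => dZ L (Ls k)) atTop (𝓝 0)}

/-- The adjoint subspace `L* = {(v*, u*) | (u*, -v*) ∈ L⊥}`. -/
def adjointSubspace (L : Submodule ℝ (Pair E)) : Submodule ℝ (Pair E) where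
  carrier := {w | pair w.snd (-w.fst) ∈ Lᗮ}
  add_mem' := by
    intro a b ha hb
    have h := Lᗮ.add_mem ha hb
    have e : pair a.snd (-a.fst) + pair b.snd (-b.fst) = pair (a + b).snd (-(a + b).fst) := by
      rw [pair, pair, ← WithLp.toLp_add]
      simp [add_comm]
    simpa only [Set.mem_ofPred_eq, e] using h
  zero_mem' := by
    have e : pair (0 : Pair E).snd (-(0 : Pair E).fst) = 0 := by simp [pair]
    simp only [Set.mem_ofPred_eq, e]
    exact Lᗮ.zero_mem
  smul_mem' := by
    intro c a ha
    have h := Lᗮ.smul_mem c ha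
    have e : c • pair a.snd (-a.fst) = pair (c • a).snd (-(c • a).fst) := by
      rw [pair, ← WithLp.toLp_smul]
      simp
    simpa only [Set.mem_ofPred_eq, e] using h

/-- The adjoint SC derivative. -/
def scAdjoint (G : E → Set E) (z : Pair E) : Set (Submodule ℝ (Pair E)) :=
  adjointSubspace '' scDeriv G z

/-- `G` has the SCD property around `z`. -/
def HasSCDPropertyAround (G : E → Set E) (z : Pair E) : Prop :=
  ∃ V ∈ 𝓝 z, ∀ z' ∈ gph G ∩ V, (scDeriv G z').Nonempty

/-- `G` is SCD semismooth* at the point `z₀ = (x₀, y₀)` of its graph. The elements of an adjoint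
subspace are written `w = (y*, x*)`. -/
def IsSCDSemismooth (G : E → Set E) (z₀ : Pair E) : Prop :=
  z₀ ∈ gph G ∧ HasSCDPropertyAround G z₀ ∧
    ∀ ε : ℝ, 0 < ε → ∃ δ : ℝ, 0 < δ ∧
      ∀ z ∈ gph G ∩ Metric.closedBall z₀ δ, ∀ M ∈ scAdjoint G z, ∀ w ∈ M,
        |inner ℝ w.snd (z.fst - z₀.fst) - inner ℝ w.fst (z.snd - z₀.snd)|
          ≤ ε * ‖z - z₀‖ * ‖w‖

/-! ### Convex functions -/

/-- The Moreau-Rockafellar subdifferential of an extended real-valued function; it is empty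
outside the effective domain. -/
def subdifferential (q : E → EReal) (x : E) : Set E :=
  {v | q x ≠ ⊥ ∧ q x ≠ ⊤ ∧ ∀ y, q x + ((inner ℝ v (y - x) : ℝ) : EReal) ≤ q y}

/-- `z` is a value of the proximal mapping of `φ` at `x`, that is, a point of
`arg min_z { ‖z - x‖² / 2 + φ z }`. -/
def IsProx (φ : E → EReal) (x z : E) : Prop :=
  φ z ≠ ⊤ ∧ ∀ w, ((‖z - x‖ ^ 2 / 2 : ℝ) : EReal) + φ z ≤ ((‖w - x‖ ^ 2 / 2 : ℝ) : EReal) + φ w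

/-- `x` solves the generalized equation `0 ∈ H x + ∂q x`. -/
def IsSolution (H : E → E) (q : E → EReal) (x : E) : Prop :=
  ∃ v ∈ subdifferential q x, H x + v = 0

end General

/-! ### The pairs `(P, W)` and the SCD semismooth* Newton method in `ℝ^ι` -/

section Newton

variable {ι : Type*} [Fintype ι] [DecidableEq ι]

/-- `rge (P, W) = {(P p, W p) | p ∈ ℝ^ι}`. -/
def rgePair (P W : Matrix ι ι ℝ) : Submodule ℝ (Pair (EuclideanSpace ℝ ι)) :=
  (LinearMap.range (P.toEuclideanLin.prod W.toEuclideanLin)).map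
    (WithLp.linearEquiv 2 ℝ (EuclideanSpace ℝ ι × EuclideanSpace ℝ ι)).symm.toLinearMap

/-- The set `ℳ_{P,W} G (z)` of pairs of symmetric matrices `(P, W)` with `P² = P`,
`W (I - P) = I - P` and `rge (P, W) ∈ 𝒮 G (z)`. -/
def matPW (G : EuclideanSpace ℝ ι → Set (EuclideanSpace ℝ ι)) (z : Pair (EuclideanSpace ℝ ι)) :
    Set (Matrix ι ι ℝ × Matrix ι ι ℝ) :=
  {PW | PW.1.IsSymm ∧ PW.2.IsSymm ∧ PW.1 * PW.1 = PW.1 ∧ PW.2 * (1 - PW.1) = 1 - PW.1 ∧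
    rgePair PW.1 PW.2 ∈ scDeriv G z}

/-- The Jacobian matrix `∇H(x)`. -/
def jacobian (H : EuclideanSpace ℝ ι → EuclideanSpace ℝ ι) (x : EuclideanSpace ℝ ι) :
    Matrix ι ι ℝ :=
  Matrix.of fun i j => fderiv ℝ H x (EuclideanSpace.single j 1) i

/-- The dual component `z* = (x - z) / lam - H x` of the approximation step. -/
def dualPoint (H : EuclideanSpace ℝ ι → EuclideanSpace ℝ ι) (lam : ℝ)
    (x z : EuclideanSpace ℝ ι) : EuclideanSpace ℝ ι :=
  lam⁻¹ • (x - z) - H x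

/-- `z = prox_{lam q} (x - lam H x)`, the primal component of the approximation step. -/
def IsApproximation (H : EuclideanSpace ℝ ι → EuclideanSpace ℝ ι)
    (q : EuclideanSpace ℝ ι → EReal) (lam : ℝ) (x z : EuclideanSpace ℝ ι) : Prop :=
  IsProx (fun y => (lam : EReal) * q y) (x - lam • H x) z

/-- `x'` is a possible successor of the iterate `x` in the SCD semismooth* Newton method with
parameter `lam` for the generalized equation `0 ∈ H x + ∂q x`: with `z` and `z*` from the
approximation step and some pair `(P, W) ∈ ℳ_{P,W} ∂q (z, z*)`, one has `x' = z + d`, where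
`(P ∇H(x) P + W) d = - P (∇H(x) - I / lam) (z - x)`. -/
def NewtonStep (H : EuclideanSpace ℝ ι → EuclideanSpace ℝ ι)
    (q : EuclideanSpace ℝ ι → EReal) (lam : ℝ) (x x' : EuclideanSpace ℝ ι) : Prop :=
  ∃ z d : EuclideanSpace ℝ ι, ∃ P W : Matrix ι ι ℝ,
    IsApproximation H q lam x z ∧
    (P, W) ∈ matPW (subdifferential q) (pair z (dualPoint H lam x z)) ∧
    (P * jacobian H x * P + W).toEuclideanLin d =
      -(P * (jacobian H x - lam⁻¹ • (1 : Matrix ι ι ℝ))).toEuclideanLin (z - x) ∧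
    x' = z + d

/-- One step of the method can be carried out at `x`, whatever pair `(P, W)` is selected:
the proximal point `z` exists and is unique, `(z, z*)` lies in the graph of `∂q`, there is a pair
`(P, W) ∈ ℳ_{P,W} ∂q (z, z*)` to be selected, and for each such pair the matrix of the Newton
system is nonsingular. -/
def StepWellDefined (H : EuclideanSpace ℝ ι → EuclideanSpace ℝ ι)
    (q : EuclideanSpace ℝ ι → EReal) (lam : ℝ) (x : EuclideanSpace ℝ ι) : Prop :=
  (∃! z, IsApproximation H q lam x z) ∧
    ∀ z, IsApproximation H q lam x z →
      pair z (dualPoint H lam x z) ∈ gph (subdifferential q) ∧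
      (matPW (subdifferential q) (pair z (dualPoint H lam x z))).Nonempty ∧
      ∀ P W : Matrix ι ι ℝ,
        (P, W) ∈ matPW (subdifferential q) (pair z (dualPoint H lam x z)) →
          IsUnit (P * jacobian H x * P + W)

/-- The sequence `x` converges superlinearly to `a`. -/
def ConvergesSuperlinearly {F : Type*} [NormedAddCommGroup F] (x : ℕ → F) (a : F) : Prop :=
  Tendsto x atTop (𝓝 a) ∧ (fun k => x (k + 1) - a) =o[atTop] (fun k => x k - a)

/-- Local superlinear convergence of the method to `a`, for a given parameter `lam`: for all
starting points near `a`, each step that is reached can be carried out, and each sequence that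
the method can generate converges superlinearly to `a`. -/
def NewtonConvergesLocally (H : EuclideanSpace ℝ ι → EuclideanSpace ℝ ι)
    (q : EuclideanSpace ℝ ι → EReal) (lam : ℝ) (a : EuclideanSpace ℝ ι) : Prop :=
  ∃ U ∈ 𝓝 a, ∀ x₀ ∈ U,
    (∀ y, Relation.ReflTransGen (NewtonStep H q lam) x₀ y → StepWellDefined H q lam y) ∧
    ∀ x : ℕ → EuclideanSpace ℝ ι, x 0 = x₀ → (∀ k, NewtonStep H q lam (x k) (x (k + 1))) →
      ConvergesSuperlinearly x a

end Newton

end SCD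

/-! ### The discretized Stokes problem with Navier-Tresca conditions -/

namespace Stokes

/-- Velocity degrees of freedom: three components at each of the `nS` nodes on the stick-slip
boundary (`Sum.inl`) and at each of the `nI` remaining nodes (`Sum.inr`). -/
abbrev VelIdx (nS nI : ℕ) : Type := (Fin nS ⊕ Fin nI) × Fin 3

/-- All degrees of freedom: velocity components and `nP` nodal pressures. -/
abbrev Idx (nS nI nP : ℕ) : Type := VelIdx nS nI ⊕ Fin nP

/-- The vectors `x = (u, p̂)`. -/
abbrev State (nS nI nP : ℕ) : Type := EuclideanSpace ℝ (Idx nS nI nP)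

/-- The data of the algebraic formulation: the matrices `A = A_κ`, `B`, `E`, the right-hand
sides `b`, `c`, and, at each node of the stick-slip boundary, the matrix `T` whose rows are the
two tangents, the matrix `N` whose row is the normal, and the slip bound `g`. -/
structure Data (nS nI nP : ℕ) where
  A : Matrix (VelIdx nS nI) (VelIdx nS nI) ℝ
  B : Matrix (Fin nP) (VelIdx nS nI) ℝ
  E : Matrix (Fin nP) (Fin nP) ℝ
  b : VelIdx nS nI → ℝ
  c : Fin nP → ℝ
  T : Fin nS → Matrix (Fin 2) (Fin 3) ℝ
  N : Fin nS → Matrix (Fin 1) (Fin 3) ℝ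
  g : Fin nS → ℝ

namespace Data

variable {nS nI nP : ℕ} (D : Data nS nI nP)

/-- The matrix `Q^i` with the two tangents and the normal as its rows. -/
def Q (i : Fin nS) : Matrix (Fin 2 ⊕ Fin 1) (Fin 3) ℝ := Matrix.fromRows (D.T i) (D.N i)

/-- The affine mapping `H(u, p̂) = (A u - Bᵀ p̂ - b, B u + E p̂ - c)`. -/
def H (x : State nS nI nP) : State nS nI nP :=
  (Matrix.fromBlocks D.A (-D.B.transpose) D.B D.E).toEuclideanLin x
    - WithLp.toLp 2 (Sum.elim D.b D.c)

/-- The velocity `u^i ∈ ℝ³` at the node `i` of the stick-slip boundary. -/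
def slipVelocity (x : State nS nI nP) (i : Fin nS) : Fin 3 → ℝ :=
  fun j => x (Sum.inl (Sum.inl i, j))

open Classical in
/-- The function `q_i(v) = g_i ‖T^i v‖ + δ_{S^i}(v)`, `S^i = {v | N^i v = 0}`. -/
def qNode (i : Fin nS) (v : Fin 3 → ℝ) : EReal :=
  ((D.g i * ‖(WithLp.toLp 2 ((D.T i).mulVec v) : EuclideanSpace ℝ (Fin 2))‖ : ℝ) : EReal)
    + (if (D.N i).mulVec v = 0 then 0 else ⊤)

/-- The function `q(u, p̂) = ∑_i q_i(u^i)`, the sum over the nodes of the stick-slip boundary. -/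
def q (x : State nS nI nP) : EReal := ∑ i, D.qNode i (slipVelocity x i)

/-- The embedding of the velocity components at the remaining nodes. -/
def incl (k : Fin nI × Fin 3) : VelIdx nS nI := (Sum.inr k.1, k.2)

/-- The matrix of the discretized Stokes problem with no-slip conditions, in which the velocities
at the nodes of the stick-slip boundary are set to zero. -/
def noSlipMatrix : Matrix ((Fin nI × Fin 3) ⊕ Fin nP) ((Fin nI × Fin 3) ⊕ Fin nP) ℝ :=
  Matrix.fromBlocks (D.A.submatrix incl incl) (-(D.B.submatrix id incl).transpose)
    (D.B.submatrix id incl) D.E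

/-- The right-hand side of the discretized Stokes problem with no-slip conditions. -/
def noSlipRhs : (Fin nI × Fin 3) ⊕ Fin nP → ℝ := Sum.elim (fun k => D.b (incl k)) D.c

end Data

end Stokes

end

/-! The graph of `∂q` is studied through the resolvent `J = (I + ∂q)⁻¹`. Since `∂q` is monotone, `J`
is nonexpansive, and `(x, y) ↦ x + y` maps the graph bijectively onto the whole space, with inverse
`w ↦ (J w, w - J w)`. The tangent cone at `(x, y)` is an `m`-dimensional subspace exactly when `J`
is differentiable at `x + y`, and that subspace is then `{(D s, s - D s)}` with `D` the derivative.
All statements about SC derivatives thus become statements about derivatives of `J` at nearby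
points.

Here `J` is explicit: it drops the normal velocities at the slip nodes, applies soft thresholding to
each tangential velocity, and is the identity on the remaining coordinates. Soft thresholding is
zero on a ball and smooth outside it, hence semismooth. Every point is a limit of points where the
derivative of `J` is one fixed symmetric map; diagonalizing that map produces a pair `(P, W)`.

For regularity, let `R` be the projection that erases the slip velocities. Every tangent `(a, b)`
satisfies `⟨a, b⟩ ≥ 0` by monotonicity, and `R b = 0` because subgradients live on the slip
velocities. Both conditions pass to limits and define a closed cone. With `M = ∇H`, the equation `Mᵀ
a + b = 0` on this cone gives `uᵀ A u + pᵀ E p ≤ 0`, so `u = 0` and `E p = 0`; then `R b = 0` gives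
`B_Iᵀ p = 0`, and the no-slip system forces `p = 0`. Compactness yields `c ‖(a, b)‖ ≤ ‖Mᵀ a + b‖`
uniformly over the entire graph, so every Newton matrix is invertible.

For convergence, the new error `h` is written as `Mᵀ (P s) + W s`. Since `rge (P, W)` lies in its
own adjoint, the semismoothness inequality may be applied to `(P s, W s)`; it bounds `‖h‖²` by a
small multiple of `‖(z, z*) - (x̄, -H x̄)‖ ‖h‖`, and the first of these factors is `O(‖x - x̄‖)`. -/

noncomputable section

namespace SCD

/-! ### Graphs parametrized by a nonexpansive resolvent -/

section Resolvent

variable {E : Type*}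

theorem pair_fst (x y : E) : (pair x y).fst = x := rfl

theorem pair_snd (x y : E) : (pair x y).snd = y := rfl

theorem pair_fst_snd (z : Pair E) : pair z.fst z.snd = z := rfl

variable [NormedAddCommGroup E]

theorem norm_pair_sq (x y : E) : ‖pair x y‖ ^ 2 = ‖x‖ ^ 2 + ‖y‖ ^ 2 :=
  WithLp.prod_norm_sq_eq_of_L2 _

theorem norm_fst_le (z : Pair E) : ‖z.fst‖ ≤ ‖z‖ := by
  have h := WithLp.prod_norm_sq_eq_of_L2 z
  nlinarith [norm_nonneg z, norm_nonneg z.fst, sq_nonneg ‖z.snd‖]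

theorem norm_snd_le (z : Pair E) : ‖z.snd‖ ≤ ‖z‖ := by
  have h := WithLp.prod_norm_sq_eq_of_L2 z
  nlinarith [norm_nonneg z, norm_nonneg z.snd, sq_nonneg ‖z.fst‖]

theorem norm_le_norm_fst_add_norm_snd (z : Pair E) : ‖z‖ ≤ ‖z.fst‖ + ‖z.snd‖ := by
  have h := WithLp.prod_norm_sq_eq_of_L2 z
  nlinarith [norm_nonneg z, norm_nonneg z.fst, norm_nonneg z.snd]

theorem continuous_pair_fst : Continuous fun z : Pair E => z.fst :=
  continuous_fst.comp (WithLp.prod_continuous_ofLp 2 E E)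

theorem continuous_pair_snd : Continuous fun z : Pair E => z.snd :=
  continuous_snd.comp (WithLp.prod_continuous_ofLp 2 E E)

theorem tendsto_pair {α : Type*} {l : Filter α} {f g : α → E} {x y : E}
    (hf : Tendsto f l (𝓝 x)) (hg : Tendsto g l (𝓝 y)) :
    Tendsto (fun k => pair (f k) (g k)) l (𝓝 (pair x y)) :=
  ((WithLp.prod_continuous_toLp 2 E E).tendsto (x, y)).comp (hf.prodMk_nhds hg)

/-- `J = (I + G)⁻¹`, a single-valued map defined on the whole space. -/
def IsResolvent (G : E → Set E) (J : E → E) : Prop := ∀ x y, y ∈ G x ↔ J (x + y) = x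

theorem IsResolvent.mem_gph_iff {G : E → Set E} {J : E → E} (h : IsResolvent G J) (z : Pair E) :
    z ∈ gph G ↔ J (z.fst + z.snd) = z.fst := h _ _

theorem IsResolvent.pair_mem_gph {G : E → Set E} {J : E → E} (h : IsResolvent G J) (w : E) :
    pair (J w) (w - J w) ∈ gph G := by
  rw [h.mem_gph_iff]; simp

variable [InnerProductSpace ℝ E]

theorem inner_pair_left (x y : E) (w : Pair E) :
    (inner ℝ (pair x y) w : ℝ) = inner ℝ x w.fst + inner ℝ y w.snd :=
  WithLp.prod_inner_apply _ w

/-- The graph of a linear map `G` with resolvent `D`, that is, `{(D s, s - D s) | s}`. -/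
def resolventGraph (D : E →L[ℝ] E) : Submodule ℝ (Pair E) where
  carrier := {z | D (z.fst + z.snd) = z.fst}
  add_mem' := by
    intro a b ha hb
    have e : (a + b).fst + (a + b).snd = (a.fst + a.snd) + (b.fst + b.snd) := by
      simp only [WithLp.add_fst, WithLp.add_snd]; abel
    simp only [Set.mem_ofPred_eq] at ha hb ⊢
    rw [e, map_add, ha, hb, WithLp.add_fst]
  zero_mem' := by simp
  smul_mem' := by
    intro c a ha
    simp only [Set.mem_ofPred_eq] at ha ⊢
    rw [WithLp.smul_fst, WithLp.smul_snd, ← smul_add, map_smul, ha]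

theorem mem_resolventGraph {D : E →L[ℝ] E} {z : Pair E} :
    z ∈ resolventGraph D ↔ D (z.fst + z.snd) = z.fst := Iff.rfl

theorem pair_mem_resolventGraph (D : E →L[ℝ] E) (s : E) :
    pair (D s) (s - D s) ∈ resolventGraph D := by
  rw [mem_resolventGraph]; simp

/-- The parametrization `s ↦ (D s, s - D s)`. -/
def resolventGraphEquiv (D : E →L[ℝ] E) : E ≃ₗ[ℝ] resolventGraph D where
  toFun s := ⟨pair (D s) (s - D s), pair_mem_resolventGraph D s⟩
  map_add' s t := by
    ext1
    simp only [Submodule.coe_add, pair, ← WithLp.toLp_add, Prod.mk_add_mk, map_add]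
    congr 2; abel
  map_smul' c s := by
    ext1
    simp [pair, ← WithLp.toLp_smul, smul_sub]
  invFun z := z.1.fst + z.1.snd
  left_inv s := by simp
  right_inv z := by
    have h : D (z.1.fst + z.1.snd) = z.1.fst := z.2
    ext1
    simp only [h, add_sub_cancel_left]
    exact pair_fst_snd _

theorem resolventGraph_mem_Z (D : E →L[ℝ] E) : resolventGraph D ∈ Z E :=
  (resolventGraphEquiv D).finrank_eq.symm

theorem mem_tangentCone_gph {G : E → Set E} {J : E → E} (hG : IsResolvent G J) {z v : Pair E}
    (hv : v ∈ tangentCone (gph G) z) :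
    ∃ (t : ℕ → ℝ) (a s : ℕ → E), (∀ k, 0 < t k) ∧ Tendsto t atTop (𝓝 0) ∧
      Tendsto a atTop (𝓝 v.fst) ∧ Tendsto s atTop (𝓝 (v.fst + v.snd)) ∧
      ∀ k, J (z.fst + z.snd + t k • s k) = z.fst + t k • a k := by
  obtain ⟨t, w, ht, ht0, hw, hmem⟩ := hv
  have h1 := (continuous_pair_fst.tendsto v).comp hw
  have h2 := (continuous_pair_snd.tendsto v).comp hw
  refine ⟨t, fun k => (w k).fst, fun k => (w k).fst + (w k).snd, ht, ht0, h1, h1.add h2,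
    fun k => ?_⟩
  have h := (hG.mem_gph_iff _).1 (hmem k)
  simp only [WithLp.add_fst, WithLp.add_snd, WithLp.smul_fst, WithLp.smul_snd] at h
  rw [← h]
  congr 1
  rw [smul_add]; abel

/-- In the coordinate `w = x + y` the graph is `w ↦ (J w, w - J w)`, so tangent vectors are the
limits of difference quotients of this parametrization. -/
theorem tangentCone_gph_of_hasFDerivAt {G : E → Set E} {J : E → E} (hG : IsResolvent G J)
    {z : Pair E} (hz : z ∈ gph G) {D : E →L[ℝ] E} (hD : HasFDerivAt J D (z.fst + z.snd)) :
    tangentCone (gph G) z = resolventGraph D := by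
  have hz' := (hG.mem_gph_iff z).1 hz
  apply Set.Subset.antisymm
  · intro v hv
    obtain ⟨t, a, s, ht, ht0, ha, hs, h⟩ := mem_tangentCone_gph hG hv
    have hd : Tendsto (fun k => t k • s k) atTop (𝓝 0) := by
      simpa using ht0.smul hs
    have hc : Tendsto (fun k => (t k)⁻¹ • (t k • s k)) atTop (𝓝 (v.fst + v.snd)) := by
      refine hs.congr fun k => ?_
      rw [smul_smul, inv_mul_cancel₀ (ht k).ne', one_smul]
    have hlim := (hasFDerivWithinAt_univ.2 hD).lim hd (.of_forall fun _ => Set.mem_univ _) hc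
    refine tendsto_nhds_unique hlim (ha.congr fun k => ?_)
    rw [h, hz', add_sub_cancel_left, smul_smul, inv_mul_cancel₀ (ht k).ne', one_smul]
  · intro v hv
    have hv' : D (v.fst + v.snd) = v.fst := hv
    set s := v.fst + v.snd with hs
    have hpos : ∀ k : ℕ, (0 : ℝ) < (k : ℝ) + 1 := fun k => by positivity
    have hlim := hD.lim s (c := fun k : ℕ => ((k : ℝ) + 1)) (l := atTop) (by
      refine tendsto_norm_atTop_atTop.comp ?_
      exact tendsto_atTop_add_const_right _ _ tendsto_natCast_atTop_atTop)
    rw [hv', hz'] at hlim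
    refine ⟨fun k : ℕ => ((k : ℝ) + 1)⁻¹, fun k => pair
      (((k : ℝ) + 1) • (J (z.fst + z.snd + ((k : ℝ) + 1)⁻¹ • s) - z.fst))
      (s - ((k : ℝ) + 1) • (J (z.fst + z.snd + ((k : ℝ) + 1)⁻¹ • s) - z.fst)),
      fun k => inv_pos.2 (hpos k), ?_, ?_, fun k => ?_⟩
    · simpa [one_div] using tendsto_one_div_add_atTop_nhds_zero_nat (𝕜 := ℝ)
    · have := tendsto_pair hlim ((tendsto_const_nhds (x := s)).sub hlim)
      have e : pair v.fst (s - v.fst) = v := by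
        rw [hs, add_sub_cancel_left]; exact pair_fst_snd v
      rwa [e] at this
    · rw [hG.mem_gph_iff]
      simp only [WithLp.add_fst, WithLp.add_snd, WithLp.smul_fst, WithLp.smul_snd, pair_fst, pair_snd, smul_sub,
        smul_smul, inv_mul_cancel₀ (hpos k).ne', one_smul]
      rw [add_sub_cancel]
      congr 1
      abel

theorem isGraphTangent_of_hasFDerivAt {G : E → Set E} {J : E → E} (hG : IsResolvent G J)
    {w : E} {D : E →L[ℝ] E} (hD : HasFDerivAt J D w) :
    IsGraphTangent G (pair (J w) (w - J w)) (resolventGraph D) := by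
  refine ⟨hG.pair_mem_gph w, resolventGraph_mem_Z D, ?_⟩
  rw [tangentCone_gph_of_hasFDerivAt hG (hG.pair_mem_gph w) (by simpa using hD)]

variable [FiniteDimensional ℝ E]

/-- Nonexpansiveness makes `v ↦ v.fst + v.snd` injective on the tangent space, and the dimension
makes it bijective, so `L` is the resolvent graph of a linear `D`. If `D` were not the Fréchet
derivative, compactness would turn a sequence of bad displacements into a tangent vector outside
`L`. -/
theorem IsGraphTangent.exists_hasFDerivAt {G : E → Set E} {J : E → E} (hG : IsResolvent G J)
    (hJ : LipschitzWith 1 J) {z : Pair E} {L : Submodule ℝ (Pair E)}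
    (hL : IsGraphTangent G z L) :
    ∃ D, HasFDerivAt J D (z.fst + z.snd) ∧ L = resolventGraph D := by
  obtain ⟨hz, hdim, htan⟩ := hL
  have hz' := (hG.mem_gph_iff z).1 hz
  have hJ' : ∀ x y, ‖J x - J y‖ ≤ ‖x - y‖ := fun x y => by
    simpa [dist_eq_norm] using hJ.dist_le_mul x y
  let σ : L →ₗ[ℝ] E :=
    { toFun := fun v => v.1.fst + v.1.snd
      map_add' := fun a b => by simp; abel
      map_smul' := fun c a => by simp }
  have hσ : ∀ v, σ v = v.1.fst + v.1.snd := fun _ => rfl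
  have hinj : Function.Injective σ := by
    rw [← LinearMap.ker_eq_bot, LinearMap.ker_eq_bot']
    intro v hv
    have hv' : v.1 ∈ tangentCone (gph G) z := htan ▸ v.2
    obtain ⟨t, a, s, ht, ht0, ha, hs, h⟩ := mem_tangentCone_gph hG hv'
    have hle : ∀ k, ‖a k‖ ≤ ‖s k‖ := fun k => by
      have := hJ' (z.fst + z.snd + t k • s k) (z.fst + z.snd)
      rw [h, hz', add_sub_cancel_left, add_sub_cancel_left, norm_smul, norm_smul] at this
      exact le_of_mul_le_mul_left this (norm_pos_iff.2 (ht k).ne')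
    have hn : ‖v.1.fst‖ ≤ ‖v.1.fst + v.1.snd‖ := le_of_tendsto_of_tendsto' ha.norm hs.norm hle
    rw [hσ] at hv
    rw [hv, norm_zero, norm_le_zero_iff] at hn
    have h2 : v.1.snd = 0 := by simpa [hn] using hv
    apply Subtype.ext
    rw [Submodule.coe_zero, ← norm_le_zero_iff]
    have := norm_le_norm_fst_add_norm_snd v.1
    simpa [hn, h2] using this
  let e : L ≃ₗ[ℝ] E := LinearEquiv.ofInjectiveOfFinrankEq σ hinj hdim
  let D₀ : E →ₗ[ℝ] E :=
    { toFun := fun s => (e.symm s).1.fst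
      map_add' := fun a b => by simp
      map_smul' := fun c a => by simp }
  let D : E →L[ℝ] E := LinearMap.toContinuousLinearMap D₀
  have hDL : ∀ v ∈ L, D (v.fst + v.snd) = v.fst := fun v hv => by
    have : e ⟨v, hv⟩ = v.fst + v.snd := rfl
    have h2 : D (v.fst + v.snd) = (e.symm (v.fst + v.snd)).1.fst := rfl
    rw [h2, ← this, LinearEquiv.symm_apply_apply]
  have hLD : L = resolventGraph D := by
    refine Submodule.eq_of_le_of_finrank_eq (fun v hv => hDL v hv) ?_
    rw [hdim, resolventGraph_mem_Z D]
  refine ⟨D, ?_, hLD⟩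
  rw [hasFDerivAt_iff_isLittleO_nhds_zero]
  by_contra hcon
  rw [Asymptotics.isLittleO_iff] at hcon
  push Not at hcon
  obtain ⟨c, hc, hfreq⟩ := hcon
  obtain ⟨d, hd0, hd⟩ := exists_seq_forall_of_frequently hfreq
  have hdne : ∀ n, 0 < ‖d n‖ := fun n => by
    rw [norm_pos_iff]
    intro h0
    have := hd n
    simp [h0] at this
  let w := z.fst + z.snd
  let s : ℕ → E := fun n => ‖d n‖⁻¹ • d n
  let a : ℕ → E := fun n => ‖d n‖⁻¹ • (J (w + d n) - J w)
  have hmem : ∀ n, (s n, a n) ∈ Metric.closedBall (0 : E) 1 ×ˢ Metric.closedBall (0 : E) 1 := by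
    intro n
    have h1 := hJ' (w + d n) w
    rw [add_sub_cancel_left] at h1
    refine ⟨?_, ?_⟩
    · rw [mem_closedBall_zero_iff, norm_smul, norm_inv, norm_norm, inv_mul_cancel₀ (hdne n).ne']
    · rw [mem_closedBall_zero_iff, norm_smul, norm_inv, norm_norm, inv_mul_le_iff₀ (hdne n),
        mul_one]
      exact h1
  obtain ⟨⟨s₀, a₀⟩, -, φ, hφ, hlim⟩ :=
    ((isCompact_closedBall (0 : E) 1).prod (isCompact_closedBall (0 : E) 1)).tendsto_subseq hmem
  have hs : Tendsto (fun n => s (φ n)) atTop (𝓝 s₀) := (continuous_fst.tendsto _).comp hlim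
  have ha : Tendsto (fun n => a (φ n)) atTop (𝓝 a₀) := (continuous_snd.tendsto _).comp hlim
  -- The normalized bad increments converge to a tangent vector, with step lengths `‖d (φ n)‖`.
  have hT : pair a₀ (s₀ - a₀) ∈ tangentCone (gph G) z := by
    refine ⟨fun n => ‖d (φ n)‖, fun n => pair (a (φ n)) (s (φ n) - a (φ n)),
      fun n => hdne _, ?_, tendsto_pair ha (hs.sub ha), fun n => ?_⟩
    · simpa using (hd0.comp hφ.tendsto_atTop).norm
    · have hw : z.fst = J w := hz'.symm
      rw [hG.mem_gph_iff]
      simp only [WithLp.add_fst, WithLp.add_snd, WithLp.smul_fst, WithLp.smul_snd, pair_fst, pair_snd, s, a, smul_sub,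
        smul_smul, mul_inv_cancel₀ (hdne (φ n)).ne', one_smul]
      rw [← hw, add_sub_cancel]
      congr 1
      simp only [w]; abel
  rw [← htan] at hT
  have hD0 : D s₀ = a₀ := by
    have := hDL _ hT
    simpa using this
  have hge : ∀ n, c ≤ ‖a (φ n) - D (s (φ n))‖ := fun n => by
    have h1 := hd (φ n)
    have h2 : a (φ n) - D (s (φ n)) =
        ‖d (φ n)‖⁻¹ • (J (w + d (φ n)) - J w - D (d (φ n))) := by
      simp only [a, s, map_smul, smul_sub]
    rw [h2, norm_smul, norm_inv, norm_norm, le_inv_mul_iff₀ (hdne _), mul_comm]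
    exact h1.le
  have hlim2 : Tendsto (fun n => ‖a (φ n) - D (s (φ n))‖) atTop (𝓝 ‖a₀ - D s₀‖) :=
    (ha.sub ((D.continuous.tendsto _).comp hs)).norm
  have := ge_of_tendsto' hlim2 hge
  rw [hD0, sub_self, norm_zero] at this
  linarith

theorem resolventGraph_mem_scDeriv {G : E → Set E} {J : E → E} (hG : IsResolvent G J)
    (hJ : Continuous J) {z : Pair E} (hz : z ∈ gph G) {D : E →L[ℝ] E} {w : ℕ → E}
    (hw : Tendsto w atTop (𝓝 (z.fst + z.snd))) (hD : ∀ k, HasFDerivAt J D (w k)) :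
    resolventGraph D ∈ scDeriv G z := by
  refine ⟨resolventGraph_mem_Z D, fun k => pair (J (w k)) (w k - J (w k)),
    fun _ => resolventGraph D, fun k => isGraphTangent_of_hasFDerivAt hG (hD k), ?_, by simp [dZ]⟩
  have h1 := (hJ.tendsto _).comp hw
  have h2 := tendsto_pair h1 (hw.sub h1)
  rw [(hG.mem_gph_iff z).1 hz, add_sub_cancel_left] at h2
  exact h2

/-- Elements of the limit of a sequence of subspaces are limits of elements. -/
theorem tendsto_starProjection {L : Submodule ℝ (Pair E)} {Ls : ℕ → Submodule ℝ (Pair E)}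
    (h : Tendsto (fun k => dZ L (Ls k)) atTop (𝓝 0)) (v : Pair E) :
    Tendsto (fun k => (Ls k).starProjection v) atTop (𝓝 (L.starProjection v)) := by
  rw [tendsto_iff_norm_sub_tendsto_zero]
  refine squeeze_zero (fun _ => norm_nonneg _) (fun k => ?_) (by simpa using h.mul_const ‖v‖)
  rw [norm_sub_rev, ← sub_apply]
  exact ContinuousLinearMap.le_opNorm _ _

/-- A closed set that contains all tangent cones to the graph contains the subspaces of the
SC derivative. -/
theorem subset_of_mem_scDeriv {G : E → Set E} {K : Set (Pair E)} (hK : IsClosed K)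
    (hT : ∀ z ∈ gph G, tangentCone (gph G) z ⊆ K) {z : Pair E} {L : Submodule ℝ (Pair E)}
    (hL : L ∈ scDeriv G z) : (L : Set (Pair E)) ⊆ K := by
  obtain ⟨-, zs, Ls, hTan, -, hlim⟩ := hL
  intro v hv
  have h := tendsto_starProjection hlim v
  rw [Submodule.starProjection_eq_self_iff.2 hv] at h
  refine hK.mem_of_tendsto h (.of_forall fun k => hT _ (hTan k).1 ?_)
  rw [← (hTan k).2.2]
  exact Submodule.starProjection_apply_mem _ _

/-- Semismoothness at `w₀` with respect to the derivatives at nearby points. -/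
def IsSemismooth {E F : Type*} [NormedAddCommGroup E] [NormedSpace ℝ E] [NormedAddCommGroup F]
    [NormedSpace ℝ F] (J : E → F) (w₀ : E) : Prop :=
  ∀ ε : ℝ, 0 < ε → ∃ δ : ℝ, 0 < δ ∧ ∀ w, ‖w - w₀‖ ≤ δ → ∀ D : E →L[ℝ] F, HasFDerivAt J D w →
    ‖J w - J w₀ - D (w - w₀)‖ ≤ ε * ‖w - w₀‖

/-- An adjoint element is a rotated normal `e ∈ Lᗮ`. Subtracting its projections onto the
approximating tangent spaces gives normals `es k → e` at points where `J` is differentiable; the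
inequality is proved there and passed to the limit. -/
theorem IsSemismooth.isSCDSemismooth {G : E → Set E} {J : E → E} (hG : IsResolvent G J)
    (hJ : LipschitzWith 1 J) (hne : ∀ z ∈ gph G, (scDeriv G z).Nonempty) {z₀ : Pair E}
    (hz₀ : z₀ ∈ gph G) (h : IsSemismooth J (z₀.fst + z₀.snd)) : IsSCDSemismooth G z₀ := by
  refine ⟨hz₀, ⟨Set.univ, univ_mem, fun z hz => hne z hz.1⟩, fun ε hε => ?_⟩
  -- The divisor 4 absorbs two factors 2, one from `‖y.fst + y.snd‖ ≤ 2 * ‖y‖` and one from the same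
  -- bound for a difference.
  obtain ⟨δ, hδ, hsem⟩ := h (ε / 4) (by positivity)
  refine ⟨δ / 4, by positivity, ?_⟩
  rintro z ⟨hz, hzδ⟩ M ⟨L, ⟨-, zs, Ls, hTan, hzs, hlim⟩, rfl⟩ w hw
  have hwsum : ∀ y : Pair E, ‖y.fst + y.snd‖ ≤ 2 * ‖y‖ := fun y =>
    (norm_add_le _ _).trans (by linarith [norm_fst_le y, norm_snd_le y])
  set e : Pair E := pair w.snd (-w.fst) with he
  have heL : e ∈ Lᗮ := hw
  let es : ℕ → Pair E := fun k => e - (Ls k).starProjection e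
  have hes : Tendsto es atTop (𝓝 e) := by
    have h1 := tendsto_starProjection hlim e
    rw [(Submodule.starProjection_apply_eq_zero_iff L).2 heL] at h1
    simpa using (tendsto_const_nhds (x := e)).sub h1
  have hball : ∀ᶠ k in atTop, ‖zs k - z₀‖ ≤ δ / 2 := by
    have h1 : Tendsto (fun k => ‖zs k - z₀‖) atTop (𝓝 ‖z - z₀‖) :=
      (hzs.sub tendsto_const_nhds).norm
    have h2 : ‖z - z₀‖ < δ / 2 := by
      rw [Metric.mem_closedBall, dist_eq_norm] at hzδ
      linarith
    exact (h1.eventually_lt_const h2).mono fun k hk => hk.le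
  have key : ∀ᶠ k in atTop,
      |inner ℝ (es k).fst ((zs k).fst - z₀.fst) + inner ℝ (es k).snd ((zs k).snd - z₀.snd)| ≤
        ε * ‖zs k - z₀‖ * ‖es k‖ := by
    filter_upwards [hball] with k hk
    obtain ⟨D, hD, hLD⟩ := (hTan k).exists_hasFDerivAt hG hJ
    have horth : es k ∈ (Ls k)ᗮ := Submodule.sub_starProjection_mem_orthogonal e
    set y := zs k - z₀ with hy
    have hy1 : (zs k).fst - z₀.fst = y.fst := by simp [hy]
    have hy2 : (zs k).snd - z₀.snd = y.snd := by simp [hy]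
    have hw1 : (zs k).fst + (zs k).snd - (z₀.fst + z₀.snd) = y.fst + y.snd := by
      rw [← hy1, ← hy2]; abel
    have hs := hsem ((zs k).fst + (zs k).snd) (by
      rw [hw1]
      exact (hwsum y).trans (by linarith)) D hD
    rw [hw1, (hG.mem_gph_iff _).1 (hTan k).1, (hG.mem_gph_iff _).1 hz₀, hy1] at hs
    rw [hy1, hy2]
    have h0 : (inner ℝ (pair (D (y.fst + y.snd)) (y.fst + y.snd - D (y.fst + y.snd))) (es k) : ℝ)
        = 0 := by
      refine (Submodule.mem_orthogonal _ _).1 horth _ ?_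
      rw [hLD]
      exact pair_mem_resolventGraph D _
    rw [inner_pair_left, real_inner_comm, real_inner_comm (es k).snd] at h0
    -- Orthogonality to the tangent `(D s, s - D s)` with `s = y.fst + y.snd` exposes the
    -- semismoothness residual `y.fst - D s`.
    have hid : (inner ℝ (es k).fst y.fst + inner ℝ (es k).snd y.snd : ℝ) =
        inner ℝ ((es k).fst - (es k).snd) (y.fst - D (y.fst + y.snd)) := by
      simp only [inner_sub_left, inner_sub_right, inner_add_right] at h0 ⊢
      linarith
    rw [hid]
    have hes2 : ‖(es k).fst - (es k).snd‖ ≤ 2 * ‖es k‖ :=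
      (norm_sub_le _ _).trans (by linarith [norm_fst_le (es k), norm_snd_le (es k)])
    calc _ ≤ ‖(es k).fst - (es k).snd‖ * ‖y.fst - D (y.fst + y.snd)‖ := abs_real_inner_le_norm _ _
      _ ≤ (2 * ‖es k‖) * (ε / 4 * (2 * ‖y‖)) := by
          gcongr
          exact hs.trans (by gcongr; exact hwsum y)
      _ = ε * ‖y‖ * ‖es k‖ := by ring
  have hl : Tendsto (fun k => |inner ℝ (es k).fst ((zs k).fst - z₀.fst) +
      inner ℝ (es k).snd ((zs k).snd - z₀.snd)|) atTop
      (𝓝 |inner ℝ e.fst (z.fst - z₀.fst) + inner ℝ e.snd (z.snd - z₀.snd)|) := by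
    have a1 := (continuous_pair_fst.tendsto _).comp hes
    have a2 := (continuous_pair_snd.tendsto _).comp hes
    have b1 := (continuous_pair_fst.tendsto _).comp hzs
    have b2 := (continuous_pair_snd.tendsto _).comp hzs
    exact ((a1.inner (b1.sub_const _)).add (a2.inner (b2.sub_const _))).abs
  have hr : Tendsto (fun k => ε * ‖zs k - z₀‖ * ‖es k‖) atTop (𝓝 (ε * ‖z - z₀‖ * ‖e‖)) :=
    ((tendsto_const_nhds (x := ε)).mul (hzs.sub tendsto_const_nhds).norm).mul hes.norm
  have hfin := le_of_tendsto_of_tendsto hl hr key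
  have hne : ‖e‖ = ‖w‖ := by
    rw [← sq_eq_sq₀ (norm_nonneg _) (norm_nonneg _), he, norm_pair_sq, norm_neg, add_comm,
      ← WithLp.prod_norm_sq_eq_of_L2]
  rw [hne] at hfin
  simpa [he, inner_neg_left, ← sub_eq_add_neg] using hfin

end Resolvent

/-! ### Subdifferentials, proximal points and monotonicity -/

section Convex

variable {E : Type*} [NormedAddCommGroup E] [InnerProductSpace ℝ E]

theorem subdifferential_monotone (q : E → EReal) {z w : Pair E}
    (hz : z ∈ gph (subdifferential q)) (hw : w ∈ gph (subdifferential q)) :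
    0 ≤ (inner ℝ (z.fst - w.fst) (z.snd - w.snd) : ℝ) := by
  obtain ⟨hz1, hz2, hz3⟩ := hz
  obtain ⟨hw1, hw2, hw3⟩ := hw
  have h1 := hz3 w.fst
  have h2 := hw3 z.fst
  lift q z.fst to ℝ using ⟨hz2, hz1⟩ with r
  lift q w.fst to ℝ using ⟨hw2, hw1⟩ with t
  norm_cast at h1 h2
  rw [real_inner_comm]
  simp only [inner_sub_left, inner_sub_right] at h1 h2 ⊢
  linarith

/-- The subgradient inequality and the expansion `hid` show that the proximal objective at `w`
exceeds its value at `z` by at least `‖w - z‖² / 2`, which gives minimality and uniqueness together.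
-/
theorem isProx_of_mem_subdifferential {φ : E → EReal} {x z : E}
    (h : x - z ∈ subdifferential φ z) :
    IsProx φ x z ∧ ∀ z', IsProx φ x z' → z' = z := by
  obtain ⟨h1, h2, h3⟩ := h
  have hid : ∀ w, ‖w - x‖ ^ 2 / 2 = ‖z - x‖ ^ 2 / 2 - inner ℝ (x - z) (w - z) + ‖w - z‖ ^ 2 / 2 := by
    intro w
    have e : w - x = (w - z) - (x - z) := by abel
    rw [e, norm_sub_sq_real, norm_sub_rev x z, real_inner_comm]
    ring
  lift φ z to ℝ using ⟨h2, h1⟩ with r hr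
  have hbot : ∀ w, φ w ≠ ⊥ := fun w hw => by
    have := h3 w
    rw [hw, ← EReal.coe_add, le_bot_iff] at this
    exact EReal.coe_ne_bot _ this
  refine ⟨⟨by simp [← hr], fun w => ?_⟩, fun z' hz' => ?_⟩
  · rw [← hr]
    rcases eq_or_ne (φ w) ⊤ with hw | hw
    · rw [hw, EReal.coe_add_top]; exact le_top
    · have hw3 := h3 w
      lift φ w to ℝ using ⟨hw, hbot w⟩ with t
      have := hid w
      norm_cast at hw3 ⊢
      nlinarith [sq_nonneg ‖w - z‖]
  · obtain ⟨ht, hm⟩ := hz'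
    have hm' := hm z
    have hw3 := h3 z'
    rw [← hr] at hm'
    lift φ z' to ℝ using ⟨ht, hbot z'⟩ with t
    have := hid z'
    norm_cast at hw3 hm'
    have h0 : ‖z' - z‖ ^ 2 ≤ 0 := by linarith
    have h00 : ‖z' - z‖ = 0 := by nlinarith [norm_nonneg (z' - z)]
    exact sub_eq_zero.1 (norm_eq_zero.1 h00)

theorem inv_smul_mem_subdifferential {q : E → EReal} {lam : ℝ} (hlam : 0 < lam) {z v : E}
    (h : v ∈ subdifferential (fun y => (lam : EReal) * q y) z) :
    lam⁻¹ • v ∈ subdifferential q z := by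
  obtain ⟨h1, h2, h3⟩ := h
  have hz1 : q z ≠ ⊥ := fun hq => h1 (by simp only [hq, EReal.coe_mul_bot_of_pos hlam])
  have hz2 : q z ≠ ⊤ := fun hq => h2 (by simp only [hq, EReal.coe_mul_top_of_pos hlam])
  refine ⟨hz1, hz2, fun y => ?_⟩
  have h := h3 y
  lift q z to ℝ using ⟨hz2, hz1⟩ with r
  rcases eq_or_ne (q y) ⊤ with hy | hy
  · rw [hy]; exact le_top
  · have hy' : q y ≠ ⊥ := fun hq => by
      rw [hq, EReal.coe_mul_bot_of_pos hlam, ← EReal.coe_mul, ← EReal.coe_add, le_bot_iff] at h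
      exact EReal.coe_ne_bot _ h
    lift q y to ℝ using ⟨hy, hy'⟩ with t
    norm_cast at h ⊢
    rw [real_inner_smul_left]
    have : lam * (r + lam⁻¹ * inner ℝ v (y - z)) ≤ lam * t := by
      rw [mul_add, ← mul_assoc, mul_inv_cancel₀ hlam.ne', one_mul]; exact h
    exact le_of_mul_le_mul_left this hlam

/-- Exhibiting one solution `J w` of `w ∈ x + ∂q x` for each `w` suffices: monotonicity excludes a
second one. -/
theorem isResolvent_subdifferential {q : E → EReal} {J : E → E}
    (h : ∀ w, w - J w ∈ subdifferential q (J w)) : IsResolvent (subdifferential q) J := by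
  intro x y
  constructor
  · intro hy
    have := subdifferential_monotone q (z := pair x y) (w := pair (J (x + y)) (x + y - J (x + y)))
      hy (h _)
    simp only [pair_fst, pair_snd] at this
    have e : y - (x + y - J (x + y)) = -(x - J (x + y)) := by abel
    rw [e, inner_neg_right, real_inner_self_eq_norm_sq] at this
    have h0 : ‖x - J (x + y)‖ = 0 := by nlinarith [norm_nonneg (x - J (x + y))]
    exact (sub_eq_zero.1 (norm_eq_zero.1 h0)).symm
  · intro hJ
    have := h (x + y)
    rwa [hJ, add_sub_cancel_left] at this

theorem norm_le_norm_add_smul {a b : E} (h : 0 ≤ (inner ℝ a b : ℝ)) {lam : ℝ} (hlam : 0 ≤ lam) :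
    ‖a‖ ≤ ‖a + lam • b‖ := by
  rw [← sq_le_sq₀ (norm_nonneg _) (norm_nonneg _), norm_add_sq_real, real_inner_smul_right]
  nlinarith [mul_nonneg hlam h, sq_nonneg ‖lam • b‖]

theorem lipschitzWith_resolvent {q : E → EReal} {J : E → E}
    (hJ : IsResolvent (subdifferential q) J) : LipschitzWith 1 J := by
  refine LipschitzWith.of_dist_le_mul fun x y => ?_
  have h := subdifferential_monotone q (hJ.pair_mem_gph x) (hJ.pair_mem_gph y)
  simp only [pair_fst, pair_snd] at h
  have := norm_le_norm_add_smul h zero_le_one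
  rw [one_smul] at this
  rw [dist_eq_norm, dist_eq_norm, NNReal.coe_one, one_mul]
  have e : J x - J y + (x - J x - (y - J y)) = x - y := by abel
  rwa [e] at this

/-- Monotonicity between `z` and `z + t • w` is a quadratic inequality; dividing by `t²` keeps it in
the limit. -/
theorem inner_nonneg_of_mem_tangentCone {q : E → EReal} {z v : Pair E}
    (hz : z ∈ gph (subdifferential q)) (hv : v ∈ tangentCone (gph (subdifferential q)) z) :
    0 ≤ (inner ℝ v.fst v.snd : ℝ) := by
  obtain ⟨t, w, ht, -, hw, hmem⟩ := hv
  have h1 := (continuous_pair_fst.tendsto v).comp hw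
  have h2 := (continuous_pair_snd.tendsto v).comp hw
  refine ge_of_tendsto' (h1.inner h2) fun k => ?_
  have h := subdifferential_monotone q (hmem k) hz
  simp only [WithLp.add_fst, WithLp.add_snd, WithLp.smul_fst, WithLp.smul_snd,
    add_sub_cancel_left, real_inner_smul_left, real_inner_smul_right] at h
  exact nonneg_of_mul_nonneg_right (nonneg_of_mul_nonneg_right h (ht k)) (ht k)

/-- If all values of `G` are orthogonal to `e`, then so are the dual parts of tangents. -/
theorem inner_eq_zero_of_mem_tangentCone {G : E → Set E} {e : E}
    (he : ∀ z ∈ gph G, (inner ℝ e z.snd : ℝ) = 0) {z v : Pair E} (hz : z ∈ gph G)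
    (hv : v ∈ tangentCone (gph G) z) : (inner ℝ e v.snd : ℝ) = 0 := by
  obtain ⟨t, w, ht, -, hw, hmem⟩ := hv
  have h2 := (continuous_pair_snd.tendsto v).comp hw
  refine tendsto_nhds_unique ((tendsto_const_nhds (x := e)).inner h2)
    (tendsto_const_nhds.congr fun k => ?_)
  have h := he _ (hmem k)
  rw [WithLp.add_snd, WithLp.smul_snd, inner_add_right, he z hz, zero_add,
    real_inner_smul_right] at h
  exact ((mul_eq_zero.1 h).resolve_left (ht k).ne').symm

end Convex

/-- A continuous linear map without zeros in a closed cone, except the origin, is bounded below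
on the cone. -/
theorem exists_lower_bound_of_isClosed_cone {V F : Type*} [NormedAddCommGroup V] [NormedSpace ℝ V]
    [FiniteDimensional ℝ V] [NormedAddCommGroup F] [NormedSpace ℝ F] {K : Set V}
    (hK : IsClosed K) (hcone : ∀ c : ℝ, 0 < c → ∀ v ∈ K, c • v ∈ K) (T : V →L[ℝ] F)
    (hT : ∀ v ∈ K, T v = 0 → v = 0) : ∃ c : ℝ, 0 < c ∧ ∀ v ∈ K, c * ‖v‖ ≤ ‖T v‖ := by
  have hcomp : IsCompact (Metric.sphere (0 : V) 1 ∩ K) := (isCompact_sphere 0 1).inter_right hK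
  rcases (Metric.sphere (0 : V) 1 ∩ K).eq_empty_or_nonempty with hempty | hne
  · refine ⟨1, one_pos, fun v hv => ?_⟩
    rcases eq_or_ne v 0 with rfl | hv0
    · simp
    · have hn := norm_pos_iff.2 hv0
      have : ‖v‖⁻¹ • v ∈ Metric.sphere (0 : V) 1 ∩ K := by
        refine ⟨?_, hcone _ (inv_pos.2 hn) v hv⟩
        rw [mem_sphere_zero_iff_norm, norm_smul, norm_inv, norm_norm, inv_mul_cancel₀ hn.ne']
      rw [hempty] at this
      exact this.elim
  · obtain ⟨v₀, hv₀, hmin⟩ := hcomp.exists_isMinOn hne T.continuous.norm.continuousOn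
    refine ⟨‖T v₀‖, ?_, fun v hv => ?_⟩
    · rw [norm_pos_iff]
      intro h0
      have h1 := hT v₀ hv₀.2 h0
      have h2 := mem_sphere_zero_iff_norm.1 hv₀.1
      rw [h1, norm_zero] at h2
      exact zero_ne_one h2
    · rcases eq_or_ne v 0 with rfl | hv0
      · simp
      · have hn := norm_pos_iff.2 hv0
        have hmem : ‖v‖⁻¹ • v ∈ Metric.sphere (0 : V) 1 ∩ K := by
          refine ⟨?_, hcone _ (inv_pos.2 hn) v hv⟩
          rw [mem_sphere_zero_iff_norm, norm_smul, norm_inv, norm_norm, inv_mul_cancel₀ hn.ne']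
        have h := hmin hmem
        simp only [Set.mem_ofPred_eq, map_smul, norm_smul, norm_inv, norm_norm] at h
        rwa [le_inv_mul_iff₀ hn, mul_comm] at h

/-! ### Linear algebra of the Newton system for a pair `(p, w)` -/

section NewtonSystem

variable {E : Type*} [NormedAddCommGroup E] [InnerProductSpace ℝ E] {p w m m' : E →ₗ[ℝ] E}

/-- This is the adjoint of the identity `w (1 - p) = 1 - p`. -/
theorem comp_eq_of_symmetric (hp : p.IsSymmetric) (hw : w.IsSymmetric)
    (hwp : ∀ x, w (x - p x) = x - p x) (x : E) : w x - p (w x) = x - p x := by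
  refine ext_inner_right ℝ fun y => ?_
  rw [inner_sub_left, inner_sub_left, hp, hw, hw, ← inner_sub_right, ← map_sub, hwp,
    inner_sub_right, hp]

theorem inner_sub_inner_of_symmetric (hp : p.IsSymmetric) (hw : w.IsSymmetric)
    (hwp : ∀ x, w (x - p x) = x - p x) (s t : E) :
    (inner ℝ (p t) (w s) + inner ℝ (w t) (-p s) : ℝ) = 0 := by
  have h1 : p (w s) = w (p s) := by
    have h := hwp s
    rw [map_sub, ← comp_eq_of_symmetric hp hw hwp s] at h
    exact (sub_right_injective h).symm
  rw [inner_neg_right, hp, hw, h1, add_neg_cancel]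

/-- Applying `1 - p` to the equation gives `s = p s`. As `w` is the identity on the kernel of `p`,
shifting `s` by an element of that kernel cancels the missing part `(1 - p) m' p s`, so the equation
holds without the outer `p`. -/
theorem injective_newton_system (hp : p.IsSymmetric) (hw : w.IsSymmetric) (hpp : ∀ x, p (p x) = p x)
    (hwp : ∀ x, w (x - p x) = x - p x) (hinj : ∀ s, m' (p s) + w s = 0 → p s = 0)
    {s : E} (hs : p (m' (p s)) + w s = 0) : s = 0 := by
  have h1 := comp_eq_of_symmetric hp hw hwp s
  have h2 : p (m' (p s)) + p (w s) = 0 := by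
    have := congrArg p hs
    rwa [map_add, hpp, map_zero] at this
  have h3 : s = p s := by
    rw [← sub_eq_zero, ← h1, ← add_sub_add_left_eq_sub _ _ (p (m' (p s))), hs, h2, sub_zero]
  rw [h3]
  have h4 : p (s - (m' (p s) - p (m' (p s)))) = p s := by
    rw [map_sub, map_sub, hpp, sub_self, sub_zero]
  rw [← h4]
  apply hinj
  rw [h4, map_sub, hwp]
  rw [← hs]; abel

/-- The error of a Newton step in the direction `h` in terms of an element `(p s, w s)` of the
subspace with `m' (p s) + w s = h`. -/
theorem inner_newton_error (hp : p.IsSymmetric) (hw : w.IsSymmetric) (hpp : ∀ x, p (p x) = p x)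
    (hwp : ∀ x, w (x - p x) = x - p x) (hm : ∀ x y, (inner ℝ (m' x) y : ℝ) = inner ℝ x (m y))
    {lam : ℝ} {d y r s : E} (hd : p (m (p d)) + w d = -p (m r - lam⁻¹ • r)) :
    (inner ℝ (m' (p s) + w s) (y + d) : ℝ) =
      inner ℝ (w s) y - inner ℝ (p s) (-(lam⁻¹ • r) - m (y - r)) := by
  have h1 := comp_eq_of_symmetric hp hw hwp d
  have h2 : p (m (p d)) + p (w d) = -p (m r - lam⁻¹ • r) := by
    have := congrArg p hd
    rwa [map_add, hpp, map_neg, hpp] at this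
  have h3 : p d = d := by
    symm
    rw [← sub_eq_zero, ← h1, ← add_sub_add_left_eq_sub _ _ (p (m (p d))), hd, h2, sub_self]
  rw [h3] at hd
  have h4 : (inner ℝ (p s) (m d) + inner ℝ (w s) d : ℝ) = -inner ℝ (p s) (m r - lam⁻¹ • r) := by
    rw [hp, hw, ← inner_add_right, hd, inner_neg_right, hp]
  rw [inner_add_left, hm]
  simp only [map_add, map_sub, inner_add_right, inner_sub_right, inner_neg_right] at h4 ⊢
  linarith

end NewtonSystem

/-! ### From symmetric derivatives to pairs `(P, W)` -/

section Matrices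

variable {ι : Type*} [Fintype ι] [DecidableEq ι]

theorem mem_rgePair {P W : Matrix ι ι ℝ} {z : Pair (EuclideanSpace ℝ ι)} :
    z ∈ rgePair P W ↔ ∃ s, pair (P.toEuclideanLin s) (W.toEuclideanLin s) = z := by
  simp only [rgePair, Submodule.mem_map, LinearMap.mem_range]
  constructor
  · rintro ⟨_, ⟨s, rfl⟩, rfl⟩
    exact ⟨s, rfl⟩
  · rintro ⟨s, rfl⟩
    exact ⟨_, ⟨s, rfl⟩, rfl⟩

theorem isSymmetric_toEuclideanLin {P : Matrix ι ι ℝ} (h : P.IsSymm) :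
    P.toEuclideanLin.IsSymmetric :=
  Matrix.isSymmetric_toEuclideanLin_iff.2
    (by rwa [Matrix.IsHermitian, Matrix.conjTranspose_eq_transpose_of_trivial])

theorem toEuclideanLin_mul_apply (A B : Matrix ι ι ℝ) (x : EuclideanSpace ℝ ι) :
    (A * B).toEuclideanLin x = A.toEuclideanLin (B.toEuclideanLin x) := by
  rw [Matrix.toLpLin_mul_same]; rfl

theorem toEuclideanLin_one_apply (x : EuclideanSpace ℝ ι) :
    (1 : Matrix ι ι ℝ).toEuclideanLin x = x := by
  rw [Matrix.toLpLin_one]; rfl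

theorem inner_toEuclideanLin_transpose (M : Matrix ι ι ℝ) (x y : EuclideanSpace ℝ ι) :
    (inner ℝ (M.transpose.toEuclideanLin x) y : ℝ) = inner ℝ x (M.toEuclideanLin y) := by
  rw [← Matrix.conjTranspose_eq_transpose_of_trivial,
    Matrix.toEuclideanLin_conjTranspose_eq_adjoint, LinearMap.adjoint_inner_left]

/-- The parametrization `s ↦ (D s, s - D s)` is rescaled in an eigenbasis of `D` so that its first
component becomes the orthogonal projection onto the range of `D`. -/
theorem exists_rgePair_eq_resolventGraph
    (D : EuclideanSpace ℝ ι →L[ℝ] EuclideanSpace ℝ ι) (hD : D.toLinearMap.IsSymmetric) :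
    ∃ P W : Matrix ι ι ℝ, P.IsSymm ∧ W.IsSymm ∧ P * P = P ∧ W * (1 - P) = 1 - P ∧
      rgePair P W = resolventGraph D := by
  set A : Matrix ι ι ℝ := Matrix.toEuclideanLin.symm D.toLinearMap with hAdef
  have hAD : ∀ x, A.toEuclideanLin x = D x := fun x => by
    rw [hAdef, LinearEquiv.apply_symm_apply]; rfl
  have hA : A.IsHermitian := by
    rw [← Matrix.isSymmetric_toEuclideanLin_iff, hAdef, LinearEquiv.apply_symm_apply]
    exact hD
  let φ := Unitary.conjStarAlgAut ℝ _ hA.eigenvectorUnitary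
  let μ := hA.eigenvalues
  have hφ : A = φ (Matrix.diagonal μ) := hA.spectral_theorem
  have hφ1 : (1 : Matrix ι ι ℝ) = φ (Matrix.diagonal 1) := by
    rw [Matrix.diagonal_one', map_one]
  have hsymm : ∀ f : ι → ℝ, (φ (Matrix.diagonal f)).IsSymm := fun f => by
    rw [Matrix.IsSymm, ← Matrix.conjTranspose_eq_transpose_of_trivial, ← Matrix.star_eq_conjTranspose,
      ← map_star, Matrix.star_eq_conjTranspose, Matrix.diagonal_conjTranspose, star_trivial]
  -- Nonzero eigenvalues are normalized to 1. The value 1 on the kernel keeps the rescaling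
  -- invertible and makes `W` the identity there.
  let ν : ι → ℝ := fun i => if μ i = 0 then 1 else (μ i)⁻¹
  have hν : ∀ i, ν i ≠ 0 := fun i => by
    by_cases h : μ i = 0 <;> simp [ν, h]
  have hmul : ∀ f g : ι → ℝ, φ (Matrix.diagonal f) * φ (Matrix.diagonal g) =
      φ (Matrix.diagonal (f * g)) := fun f g => by
    rw [← map_mul, Matrix.diagonal_mul_diagonal]; rfl
  have hsub : ∀ f g : ι → ℝ, φ (Matrix.diagonal f) - φ (Matrix.diagonal g) =
      φ (Matrix.diagonal (f - g)) := fun f g => by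
    rw [← map_sub, Matrix.diagonal_sub]; rfl
  refine ⟨φ (Matrix.diagonal (μ * ν)), φ (Matrix.diagonal ((1 - μ) * ν)), hsymm _, hsymm _, ?_, ?_,
    ?_⟩
  · rw [hmul]
    congr 2
    ext i
    by_cases h : μ i = 0 <;> simp [ν, h]
  · rw [hφ1, hsub, hmul]
    congr 2
    ext i
    by_cases h : μ i = 0 <;> simp [ν, h]
  · have hsum : φ (Matrix.diagonal (μ * ν)) + φ (Matrix.diagonal ((1 - μ) * ν)) =
        φ (Matrix.diagonal ν) := by
      rw [← map_add, Matrix.diagonal_add]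
      congr 2
      ext i
      simp; ring
    have hP : φ (Matrix.diagonal (μ * ν)) = A * φ (Matrix.diagonal ν) := by rw [hφ, hmul]
    have hN : φ (Matrix.diagonal ν) * φ (Matrix.diagonal ν⁻¹) = 1 := by
      rw [hmul, hφ1]
      congr 2
      ext i
      simp [hν i]
    ext z
    rw [mem_rgePair, mem_resolventGraph]
    constructor
    · rintro ⟨s, rfl⟩
      rw [pair_fst, pair_snd, ← LinearMap.add_apply, ← map_add, hsum, hP, toEuclideanLin_mul_apply,
        hAD]
    · intro hz
      have h1 : (φ (Matrix.diagonal ν)).toEuclideanLin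
          ((φ (Matrix.diagonal ν⁻¹)).toEuclideanLin (z.fst + z.snd)) = z.fst + z.snd := by
        rw [← toEuclideanLin_mul_apply, hN, toEuclideanLin_one_apply]
      have h2 : (φ (Matrix.diagonal (μ * ν))).toEuclideanLin
          ((φ (Matrix.diagonal ν⁻¹)).toEuclideanLin (z.fst + z.snd)) = z.fst := by
        rw [hP, toEuclideanLin_mul_apply, h1, hAD, hz]
      refine ⟨(φ (Matrix.diagonal ν⁻¹)).toEuclideanLin (z.fst + z.snd), ?_⟩
      have h3 := eq_sub_of_add_eq' hsum
      rw [h3, map_sub, LinearMap.sub_apply, h1, h2, add_sub_cancel_left]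
      exact pair_fst_snd z

end Matrices

/-! ### Superlinear convergence of the Newton method for affine `H` -/

section NewtonConvergence

variable {ι : Type*} [Fintype ι] [DecidableEq ι]

theorem jacobian_of_affine {H : EuclideanSpace ℝ ι → EuclideanSpace ℝ ι} {M : Matrix ι ι ℝ}
    {f : EuclideanSpace ℝ ι} (hH : ∀ x, H x = M.toEuclideanLin x - f) (x : EuclideanSpace ℝ ι) :
    jacobian H x = M := by
  have hd : HasFDerivAt H (LinearMap.toContinuousLinearMap M.toEuclideanLin) x := by
    rw [show H = fun x => LinearMap.toContinuousLinearMap M.toEuclideanLin x - f from funext hH]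
    exact (ContinuousLinearMap.hasFDerivAt _).sub_const f
  ext i j
  rw [jacobian, Matrix.of_apply, hd.fderiv]
  simp [Matrix.toLpLin_apply, Matrix.col_apply]

theorem scDeriv_nonempty_and_matPW_nonempty
    {G : EuclideanSpace ℝ ι → Set (EuclideanSpace ℝ ι)}
    {J : EuclideanSpace ℝ ι → EuclideanSpace ℝ ι} (hG : IsResolvent G J) (hJ : Continuous J)
    (hD : ∀ w, ∃ (D : EuclideanSpace ℝ ι →L[ℝ] EuclideanSpace ℝ ι)
      (ws : ℕ → EuclideanSpace ℝ ι), D.toLinearMap.IsSymmetric ∧ Tendsto ws atTop (𝓝 w) ∧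
        ∀ k, HasFDerivAt J D (ws k)) {z : Pair (EuclideanSpace ℝ ι)} (hz : z ∈ gph G) :
    (scDeriv G z).Nonempty ∧ (matPW G z).Nonempty := by
  obtain ⟨D, ws, hsymm, hws, hder⟩ := hD (z.fst + z.snd)
  have hL := resolventGraph_mem_scDeriv hG hJ hz hws hder
  obtain ⟨P, W, hP, hW, hPP, hWP, hPW⟩ := exists_rgePair_eq_resolventGraph D hsymm
  exact ⟨⟨_, hL⟩, ⟨(P, W), hP, hW, hPP, hWP, hPW ▸ hL⟩⟩

variable {G : EuclideanSpace ℝ ι → Set (EuclideanSpace ℝ ι)} {M P W : Matrix ι ι ℝ}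

theorem toEuclideanLin_idempotent (hPP : P * P = P) (x : EuclideanSpace ℝ ι) :
    P.toEuclideanLin (P.toEuclideanLin x) = P.toEuclideanLin x := by
  rw [← toEuclideanLin_mul_apply, hPP]

theorem toEuclideanLin_apply_sub (hWP : W * (1 - P) = 1 - P) (x : EuclideanSpace ℝ ι) :
    W.toEuclideanLin (x - P.toEuclideanLin x) = x - P.toEuclideanLin x := by
  have h : x - P.toEuclideanLin x = (1 - P).toEuclideanLin x := by
    rw [map_sub, LinearMap.sub_apply, toEuclideanLin_one_apply]
  rw [h, ← toEuclideanLin_mul_apply, hWP]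

theorem toEuclideanLin_newton_apply (M P W : Matrix ι ι ℝ) (s : EuclideanSpace ℝ ι) :
    (P * M * P + W).toEuclideanLin s =
      P.toEuclideanLin (M.toEuclideanLin (P.toEuclideanLin s)) + W.toEuclideanLin s := by
  rw [map_add, LinearMap.add_apply, toEuclideanLin_mul_apply, toEuclideanLin_mul_apply]

/-- The adjoint Newton matrix is nonsingular. -/
theorem isUnit_newton_transpose {c : ℝ} (hc : 0 < c)
    (hreg : ∀ z, ∀ L ∈ scDeriv G z, ∀ v ∈ L,
      c * ‖v‖ ≤ ‖M.transpose.toEuclideanLin v.fst + v.snd‖)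
    {z : Pair (EuclideanSpace ℝ ι)} (hPW : (P, W) ∈ matPW G z) :
    IsUnit (P * M.transpose * P + W) := by
  obtain ⟨hP, hW, hPP, hWP, hL⟩ := hPW
  dsimp only at hP hW hPP hWP hL
  rw [← Matrix.mulVec_injective_iff_isUnit]
  refine (injective_iff_map_eq_zero (P * M.transpose * P + W).mulVecLin).2 fun s hs => ?_
  have hs' : (P * M.transpose * P + W).toEuclideanLin (WithLp.toLp 2 s) = 0 := by
    rw [Matrix.toLpLin_toLp]
    exact congrArg (WithLp.toLp 2) hs
  rw [toEuclideanLin_newton_apply] at hs'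
  have h0 := injective_newton_system (isSymmetric_toEuclideanLin hP)
    (isSymmetric_toEuclideanLin hW) (toEuclideanLin_idempotent hPP) (toEuclideanLin_apply_sub hWP)
    (fun t ht => ?_) hs'
  · exact congrArg WithLp.ofLp h0
  · have h := hreg z _ hL _ (mem_rgePair.2 ⟨t, rfl⟩)
    rw [pair_fst, pair_snd, ht, norm_zero] at h
    have h1 : ‖pair (P.toEuclideanLin t) (W.toEuclideanLin t)‖ = 0 :=
      le_antisymm (by by_contra hcon; push Not at hcon; nlinarith [mul_pos hc hcon]) (norm_nonneg _)
    have h2 := norm_fst_le (pair (P.toEuclideanLin t) (W.toEuclideanLin t))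
    rw [h1, pair_fst] at h2
    exact norm_le_zero_iff.1 h2

theorem isUnit_newton {c : ℝ} (hc : 0 < c)
    (hreg : ∀ z, ∀ L ∈ scDeriv G z, ∀ v ∈ L,
      c * ‖v‖ ≤ ‖M.transpose.toEuclideanLin v.fst + v.snd‖)
    {z : Pair (EuclideanSpace ℝ ι)} (hPW : (P, W) ∈ matPW G z) :
    IsUnit (P * M * P + W) := by
  have h := isUnit_newton_transpose hc hreg hPW
  obtain ⟨hP, hW, -⟩ := hPW
  dsimp only at hP hW
  rw [← Matrix.isUnit_transpose] at h
  rwa [Matrix.transpose_add, Matrix.transpose_mul, Matrix.transpose_mul, hP.eq, hW.eq,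
    Matrix.transpose_transpose, ← Matrix.mul_assoc] at h

/-- `rge (P, W)` is contained in its adjoint subspace. -/
theorem mem_adjointSubspace_rgePair (hP : P.IsSymm) (hW : W.IsSymm) (hWP : W * (1 - P) = 1 - P)
    (s : EuclideanSpace ℝ ι) :
    pair (P.toEuclideanLin s) (W.toEuclideanLin s) ∈ adjointSubspace (E := EuclideanSpace ℝ ι) (rgePair P W) := by
  have hPs := isSymmetric_toEuclideanLin hP
  have hWs := isSymmetric_toEuclideanLin hW
  have hwp := toEuclideanLin_apply_sub hWP
  change pair (W.toEuclideanLin s) (-P.toEuclideanLin s) ∈ (rgePair P W)ᗮ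
  rw [Submodule.mem_orthogonal]
  intro v hv
  obtain ⟨t, rfl⟩ := mem_rgePair.1 hv
  rw [inner_pair_left]
  exact inner_sub_inner_of_symmetric hPs hWs hwp s t

/-- One step of the Newton method reduces the error by a factor that is controlled by the
semismoothness modulus. -/
theorem norm_newton_error_le {c : ℝ} (hc : 0 < c)
    (hreg : ∀ z, ∀ L ∈ scDeriv G z, ∀ v ∈ L,
      c * ‖v‖ ≤ ‖M.transpose.toEuclideanLin v.fst + v.snd‖)
    {z : Pair (EuclideanSpace ℝ ι)} (hPW : (P, W) ∈ matPW G z) {z₀ : Pair (EuclideanSpace ℝ ι)}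
    {x d : EuclideanSpace ℝ ι} {lam ε : ℝ}
    (hdual : z.snd - z₀.snd = lam⁻¹ • (x - z.fst) - M.toEuclideanLin (x - z₀.fst))
    (hd : (P * M * P + W).toEuclideanLin d =
      -(P * (M - lam⁻¹ • (1 : Matrix ι ι ℝ))).toEuclideanLin (z.fst - x)) (hε : 0 ≤ ε)
    (hss : ∀ w ∈ adjointSubspace (E := EuclideanSpace ℝ ι) (rgePair P W),
      |inner ℝ w.snd (z.fst - z₀.fst) - inner ℝ w.fst (z.snd - z₀.snd)| ≤ ε * ‖z - z₀‖ * ‖w‖) :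
    c * ‖z.fst + d - z₀.fst‖ ≤ ε * ‖z - z₀‖ := by
  have hunit := isUnit_newton_transpose hc hreg hPW
  obtain ⟨hP, hW, hPP, hWP, hL⟩ := hPW
  dsimp only at hP hW hPP hWP hL
  set p := P.toEuclideanLin with hp
  set w := W.toEuclideanLin with hw
  set m := M.toEuclideanLin with hm
  set m' := M.transpose.toEuclideanLin with hm'
  set h := z.fst + d - z₀.fst with hh
  obtain ⟨s₀, hs₀⟩ : ∃ s, p (m' (p s)) + w s = h := by
    obtain ⟨s, hs⟩ := (Matrix.mulVec_surjective_iff_isUnit.2 hunit) (WithLp.ofLp h)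
    refine ⟨WithLp.toLp 2 s, ?_⟩
    rw [← toEuclideanLin_newton_apply, Matrix.toLpLin_toLp]
    exact congrArg (WithLp.toLp 2) hs
  have hpp := toEuclideanLin_idempotent hPP
  have hwp := toEuclideanLin_apply_sub hWP
  -- A shift inside the kernel of `p`, where `w` is the identity, removes the outer `p` and
  -- represents the error as `m' (p s) + w s = h`.
  set s := s₀ - (m' (p s₀) - p (m' (p s₀))) with hs
  have h1 : p s = p s₀ := by
    rw [hs, map_sub, map_sub, hpp, sub_self, sub_zero]
  have h2 : m' (p s) + w s = h := by
    rw [h1, hs, map_sub, hwp, ← hs₀]; abel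
  rw [toEuclideanLin_newton_apply, toEuclideanLin_mul_apply, map_sub Matrix.toEuclideanLin,
    map_smul Matrix.toEuclideanLin, LinearMap.sub_apply, LinearMap.smul_apply,
    toEuclideanLin_one_apply] at hd
  have h3 := inner_newton_error (s := s) (y := z.fst - z₀.fst) (isSymmetric_toEuclideanLin hP)
    (isSymmetric_toEuclideanLin hW) hpp hwp (inner_toEuclideanLin_transpose M) hd
  have h4 : -(lam⁻¹ • (z.fst - x)) - m (z.fst - z₀.fst - (z.fst - x)) = z.snd - z₀.snd := by
    rw [hdual, ← smul_neg, neg_sub]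
    congr 2
    abel
  have h5 : z.fst - z₀.fst + d = h := by rw [hh]; abel
  rw [h4, h2, h5, real_inner_self_eq_norm_sq] at h3
  have h6 := hss _ (mem_adjointSubspace_rgePair hP hW hWP s)
  simp only [pair_fst, pair_snd] at h6
  rw [← h3] at h6
  have h7 := hreg z _ hL _ (mem_rgePair.2 ⟨s, rfl⟩)
  simp only [pair_fst, pair_snd] at h7
  rw [h2] at h7
  have h8 : c * ‖h‖ ^ 2 ≤ ε * ‖z - z₀‖ * ‖h‖ := by
    calc c * ‖h‖ ^ 2 ≤ c * (ε * ‖z - z₀‖ * ‖pair (p s) (w s)‖) := by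
          gcongr
          exact (le_abs_self _).trans h6
      _ = ε * ‖z - z₀‖ * (c * ‖pair (p s) (w s)‖) := by ring
      _ ≤ ε * ‖z - z₀‖ * ‖h‖ := by gcongr
  rcases (norm_nonneg h).eq_or_lt with h0 | h0
  · rw [← h0, mul_zero]; positivity
  · rw [sq, ← mul_assoc] at h8
    exact le_of_mul_le_mul_right h8 h0

/-- The factor `1 / 2` keeps all iterates in one ball and forces convergence; afterwards every
smaller factor applies eventually. -/
theorem convergesSuperlinearly_of_local_contraction {F : Type*} [NormedAddCommGroup F]
    {R : F → F → Prop} {a : F}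
    (h : ∀ ε : ℝ, 0 < ε → ∃ δ : ℝ, 0 < δ ∧ ∀ x x', ‖x - a‖ ≤ δ → R x x' →
      ‖x' - a‖ ≤ ε * ‖x - a‖) :
    ∃ U ∈ 𝓝 a, ∀ x : ℕ → F, x 0 ∈ U → (∀ k, R (x k) (x (k + 1))) →
      ConvergesSuperlinearly x a := by
  obtain ⟨δ, hδ, hcontr⟩ := h (1 / 2) (by norm_num)
  refine ⟨Metric.closedBall a δ, Metric.closedBall_mem_nhds a hδ, fun x hx hR => ?_⟩
  rw [Metric.mem_closedBall, dist_eq_norm] at hx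
  have hbound : ∀ k, ‖x k - a‖ ≤ (1 / 2) ^ k * δ := by
    intro k
    induction k with
    | zero => simpa using hx
    | succ k ih =>
      have h1 : ((1 : ℝ) / 2) ^ k * δ ≤ δ :=
        mul_le_of_le_one_left hδ.le (pow_le_one₀ (by norm_num) (by norm_num))
      have h2 := hcontr _ _ (ih.trans h1) (hR k)
      rw [pow_succ]
      linarith
  have hlim : Tendsto x atTop (𝓝 a) := by
    rw [tendsto_iff_norm_sub_tendsto_zero]
    refine squeeze_zero (fun _ => norm_nonneg _) hbound ?_
    simpa using (tendsto_pow_atTop_nhds_zero_of_lt_one (r := (1 : ℝ) / 2) (by norm_num)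
      (by norm_num)).mul_const δ
  refine ⟨hlim, Asymptotics.isLittleO_iff.2 fun ε hε => ?_⟩
  obtain ⟨η, hη, hc⟩ := h ε hε
  filter_upwards [hlim (Metric.closedBall_mem_nhds a hη)] with k hk
  exact hc _ _ (by simpa [dist_eq_norm] using hk) (hR k)

theorem isApproximation_unique_and_mem_gph {ι : Type*} [Fintype ι]
    {H : EuclideanSpace ℝ ι → EuclideanSpace ℝ ι} {q : EuclideanSpace ℝ ι → EReal} {lam : ℝ} (hlam : 0 < lam)
    (hprox : ∀ x, ∃ z, x - z ∈ subdifferential (fun y => (lam : EReal) * q y) z)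
    (x : EuclideanSpace ℝ ι) :
    ∃ z, (IsApproximation H q lam x z ∧ ∀ z', IsApproximation H q lam x z' → z' = z) ∧
      pair z (dualPoint H lam x z) ∈ gph (subdifferential q) := by
  obtain ⟨z, hz⟩ := hprox (x - lam • H x)
  refine ⟨z, isProx_of_mem_subdifferential hz, ?_⟩
  have h := inv_smul_mem_subdifferential hlam hz
  have e : lam⁻¹ • (x - lam • H x - z) = dualPoint H lam x z := by
    rw [dualPoint, sub_right_comm, smul_sub, smul_smul, inv_mul_cancel₀ hlam.ne', one_smul]
  rwa [e] at h

/-- Local superlinear convergence for affine `H`, if `∂q` is SCD semismooth* at the solution and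
its SC derivatives satisfy a uniform regularity condition. -/
theorem newtonConvergesLocally_of_affine {H : EuclideanSpace ℝ ι → EuclideanSpace ℝ ι}
    {f : EuclideanSpace ℝ ι} (hH : ∀ x, H x = M.toEuclideanLin x - f)
    {q : EuclideanSpace ℝ ι → EReal} {lam : ℝ} (hlam : 0 < lam)
    (hprox : ∀ x, ∃ z, x - z ∈ subdifferential (fun y => (lam : EReal) * q y) z)
    (hne : ∀ z ∈ gph (subdifferential q), (matPW (subdifferential q) z).Nonempty)
    {c : ℝ} (hc : 0 < c)
    (hreg : ∀ z, ∀ L ∈ scDeriv (subdifferential q) z, ∀ v ∈ L,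
      c * ‖v‖ ≤ ‖M.transpose.toEuclideanLin v.fst + v.snd‖)
    {a : EuclideanSpace ℝ ι} (hss : IsSCDSemismooth (subdifferential q) (pair a (-H a))) :
    NewtonConvergesLocally H q lam a := by
  have happ := isApproximation_unique_and_mem_gph (H := H) hlam hprox
  -- The regularity constant does not depend on the point, so this holds at every `x`, not only near
  -- `a`.
  have hstep : ∀ x, StepWellDefined H q lam x := by
    intro x
    obtain ⟨z, ⟨hz, hzu⟩, hmem⟩ := happ x
    refine ⟨⟨z, hz, hzu⟩, fun z' hz' => ?_⟩
    rw [hzu z' hz']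
    exact ⟨hmem, hne _ hmem, fun P W hPW => by
      rw [jacobian_of_affine hH]
      exact isUnit_newton hc hreg hPW⟩
  set m := LinearMap.toContinuousLinearMap M.toEuclideanLin with hm
  have hHsub : ∀ x, H x - H a = m (x - a) := fun x => by
    rw [hH, hH, sub_sub_sub_cancel_right, map_sub]; rfl
  set C₁ : ℝ := 1 + lam * ‖m‖ with hC₁
  set C : ℝ := C₁ + (lam⁻¹ * (1 + C₁) + ‖m‖) with hC
  have hC₁pos : 0 < C₁ := by positivity
  have hCpos : 0 < C := by positivity
  have hlip : ∀ x z, pair z (dualPoint H lam x z) ∈ gph (subdifferential q) →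
      ‖pair z (dualPoint H lam x z) - pair a (-H a)‖ ≤ C * ‖x - a‖ := by
    intro x z hz
    have hmono := subdifferential_monotone q hz hss.1
    simp only [pair_fst, pair_snd] at hmono
    have hdual : dualPoint H lam x z - -H a = lam⁻¹ • (x - z) - m (x - a) := by
      rw [← hHsub, dualPoint]; abel
    -- Monotonicity bounds `z - a` by `(z - a) + lam • (z* + H a)`, which equals `(1 - lam M) (x -
    -- a)`; hence the constant `C₁`.
    have h1 := norm_le_norm_add_smul hmono hlam.le
    have e1 : z - a + lam • (dualPoint H lam x z - -H a) = (x - a) - lam • m (x - a) := by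
      rw [hdual, smul_sub, smul_smul, mul_inv_cancel₀ hlam.ne', one_smul]; abel
    have hm1 := m.le_opNorm (x - a)
    have h2 : ‖z - a‖ ≤ C₁ * ‖x - a‖ := by
      rw [e1] at h1
      refine h1.trans ((norm_sub_le _ _).trans ?_)
      rw [norm_smul, Real.norm_of_nonneg hlam.le, hC₁]
      nlinarith
    have h3 : ‖x - z‖ ≤ (1 + C₁) * ‖x - a‖ := by
      have : x - z = (x - a) - (z - a) := by abel
      rw [this]
      refine (norm_sub_le _ _).trans ?_
      linarith
    have h4 : ‖dualPoint H lam x z - -H a‖ ≤ (lam⁻¹ * (1 + C₁) + ‖m‖) * ‖x - a‖ := by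
      rw [hdual]
      refine (norm_sub_le _ _).trans ?_
      rw [norm_smul, Real.norm_of_nonneg (inv_pos.2 hlam).le, add_mul, mul_assoc]
      gcongr
    refine (norm_le_norm_fst_add_norm_snd _).trans ?_
    rw [hC, add_mul]
    exact add_le_add h2 h4
  obtain ⟨U, hU, hconv⟩ := convergesSuperlinearly_of_local_contraction (R := NewtonStep H q lam)
    (a := a) (fun ε hε => by
      -- The factor `c` pays for regularity and `1 / C` for replacing the distance in the graph by
      -- `‖x - a‖`.
      obtain ⟨δ, hδ, hest⟩ := hss.2.2 (ε * c / C) (by positivity)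
      refine ⟨δ / C, by positivity, ?_⟩
      rintro x x' hx ⟨z, d, P, W, hz, hPW, hd, rfl⟩
      obtain ⟨z₁, ⟨-, hzu⟩, hmem⟩ := happ x
      rw [← hzu z hz] at hmem
      have hl := hlip x z hmem
      rw [jacobian_of_affine hH] at hd
      have h := norm_newton_error_le (z₀ := pair a (-H a)) (ε := ε * c / C) hc hreg hPW
        (by
          simp only [pair_fst, pair_snd]
          have := hHsub x
          rw [sub_neg_eq_add, dualPoint, sub_add, this]
          rfl) hd (by positivity)
        (fun w hw => hest _ ⟨hmem, by
          rw [Metric.mem_closedBall, dist_eq_norm]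
          calc _ ≤ C * ‖x - a‖ := hl
            _ ≤ C * (δ / C) := by gcongr
            _ = δ := by field_simp⟩ _ ⟨_, hPW.2.2.2.2, rfl⟩ w hw)
      have h' : c * ‖z + d - a‖ ≤ c * (ε * ‖x - a‖) :=
        calc c * ‖z + d - a‖ ≤ ε * c / C * ‖pair z (dualPoint H lam x z) - pair a (-H a)‖ := h
          _ ≤ ε * c / C * (C * ‖x - a‖) := by gcongr
          _ = c * (ε * ‖x - a‖) := by field_simp
      exact le_of_mul_le_mul_left h' hc)
  refine ⟨U, hU, fun x₀ hx₀ => ⟨fun y _ => hstep y, fun x hx hR => hconv x (hx ▸ hx₀) hR⟩⟩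

end NewtonConvergence

/-! ### Semismoothness of continuously differentiable maps -/

section Semismooth

variable {E F : Type*} [NormedAddCommGroup E] [NormedSpace ℝ E] [NormedAddCommGroup F]
  [NormedSpace ℝ F]

theorem isSemismooth_iff_eventually {J : E → F} {w₀ : E} :
    IsSemismooth J w₀ ↔ ∀ ε : ℝ, 0 < ε → ∀ᶠ w in 𝓝 w₀, ∀ D : E →L[ℝ] F, HasFDerivAt J D w →
      ‖J w - J w₀ - D (w - w₀)‖ ≤ ε * ‖w - w₀‖ := by
  refine forall₂_congr fun ε hε => ?_
  rw [Metric.nhds_basis_closedBall.eventually_iff]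
  simp only [Metric.mem_closedBall, dist_eq_norm]

/-- The derivative is taken at the moving point `w`; its continuity makes the exchange with the
derivative at `w₀` cost only `ε / 2`. -/
theorem eventually_norm_sub_fderiv_le {f : E → F} {w₀ : E} (hf : ContDiffAt ℝ 1 f w₀)
    {ε : ℝ} (hε : 0 < ε) :
    ∀ᶠ w in 𝓝 w₀, ‖f w - f w₀ - fderiv ℝ f w (w - w₀)‖ ≤ ε * ‖w - w₀‖ := by
  have h1 : HasFDerivAt f (fderiv ℝ f w₀) w₀ := (hf.differentiableAt one_ne_zero).hasFDerivAt
  have h2 : ContinuousAt (fderiv ℝ f) w₀ := (hf.fderiv_right (m := 0) (by simp)).continuousAt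
  have h3 := Asymptotics.isLittleO_iff.1 h1.isLittleO (half_pos hε)
  have h4 := h2 (Metric.ball_mem_nhds _ (half_pos hε))
  filter_upwards [h3, h4] with w hw1 hw2
  rw [Set.mem_preimage, mem_ball_iff_norm, norm_sub_rev] at hw2
  have e : f w - f w₀ - fderiv ℝ f w (w - w₀) = (f w - f w₀ - fderiv ℝ f w₀ (w - w₀)) +
      (fderiv ℝ f w₀ - fderiv ℝ f w) (w - w₀) := by
    rw [sub_apply]; abel
  rw [e]
  refine (norm_add_le _ _).trans ?_
  have h5 : ‖(fderiv ℝ f w₀ - fderiv ℝ f w) (w - w₀)‖ ≤ ε / 2 * ‖w - w₀‖ :=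
    ((fderiv ℝ f w₀ - fderiv ℝ f w).le_opNorm _).trans (by gcongr)
  linarith

end Semismooth

/-! ### Soft thresholding -/

section Soft

variable {F : Type*} [NormedAddCommGroup F] [InnerProductSpace ℝ F]

/-- The scaling `t ↦ (1 - g / ‖t‖) t`. -/
def shrink (g : ℝ) (t : F) : F := t - (g / ‖t‖) • t

/-- Soft thresholding, the proximal mapping of `g ‖·‖`. -/
def soft (g : ℝ) (t : F) : F := if ‖t‖ ≤ g then 0 else shrink g t

theorem soft_of_le {g : ℝ} {t : F} (h : ‖t‖ ≤ g) : soft g t = 0 := if_pos h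

theorem soft_of_lt {g : ℝ} {t : F} (h : g < ‖t‖) : soft g t = shrink g t := if_neg h.not_ge

theorem soft_of_ge {g : ℝ} (hg : 0 < g) {t : F} (h : g ≤ ‖t‖) : soft g t = shrink g t := by
  rcases h.eq_or_lt with h | h
  · rw [soft_of_le h.ge, shrink, ← h, div_self hg.ne', one_smul, sub_self]
  · exact soft_of_lt h

theorem soft_zero : soft (0 : ℝ) = (id : F → F) := by
  ext t
  rcases (norm_nonneg t).eq_or_lt with h | h
  · rw [soft_of_le h.ge, id, norm_eq_zero.1 h.symm]
  · rw [soft_of_lt h, shrink, zero_div, zero_smul, sub_zero, id]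

/-- This is the subgradient inequality for `g ‖·‖` that identifies `soft g` as its resolvent; both
regimes reduce to Cauchy–Schwarz. -/
theorem soft_variational {g : ℝ} (hg : 0 ≤ g) (t η : F) :
    g * ‖soft g t‖ + inner ℝ (t - soft g t) (η - soft g t) ≤ g * ‖η‖ := by
  rcases le_or_gt ‖t‖ g with h | h
  · rw [soft_of_le h, norm_zero, mul_zero, zero_add, sub_zero, sub_zero]
    exact (real_inner_le_norm t η).trans (by gcongr)
  · have ht : 0 < ‖t‖ := hg.trans_lt h
    have e1 : t - shrink g t = (g / ‖t‖) • t := by rw [shrink, sub_sub_cancel]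
    have e2 : shrink g t = (1 - g / ‖t‖) • t := by rw [shrink, sub_smul, one_smul]
    have h1 : 0 ≤ 1 - g / ‖t‖ := by rw [sub_nonneg, div_le_one ht]; exact h.le
    rw [soft_of_lt h, e1, e2, norm_smul, Real.norm_of_nonneg h1, inner_sub_right,
      real_inner_smul_left, real_inner_smul_left, real_inner_smul_right,
      real_inner_self_eq_norm_sq]
    have h2 : g / ‖t‖ * inner ℝ t η ≤ g / ‖t‖ * (‖t‖ * ‖η‖) := by
      gcongr
      exact real_inner_le_norm t η
    have h3 : g / ‖t‖ * (‖t‖ * ‖η‖) = g * ‖η‖ := by field_simp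
    have h4 : g / ‖t‖ * ((1 - g / ‖t‖) * ‖t‖ ^ 2) = g * ((1 - g / ‖t‖) * ‖t‖) := by field_simp
    linarith

theorem contDiffAt_shrink (g : ℝ) {t : F} (ht : t ≠ 0) : ContDiffAt ℝ 1 (shrink g) t := by
  have h1 : ContDiffAt ℝ 1 (fun x : F => ‖x‖) t := contDiffAt_norm ℝ ht
  exact contDiffAt_id.sub ((contDiffAt_const.div h1 (norm_ne_zero_iff.2 ht)).smul contDiffAt_id)

/-- Symmetry holds because the gradient of `g / ‖t‖` is a multiple of `t`, so the derivative is a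
multiple of the identity plus a multiple of `t ⊗ t`. -/
theorem exists_hasFDerivAt_shrink (g : ℝ) {t : F} (ht : t ≠ 0) :
    ∃ D : F →L[ℝ] F, D.toLinearMap.IsSymmetric ∧ HasFDerivAt (shrink g) D t := by
  have hpos : ‖t‖ ^ 2 ≠ 0 := pow_ne_zero 2 (norm_ne_zero_iff.2 ht)
  have hd : DifferentiableAt ℝ (fun r : ℝ => g / √r) (‖t‖ ^ 2) :=
    (differentiableAt_const g).div (differentiableAt_id.sqrt hpos)
      (by rw [Real.sqrt_sq (norm_nonneg t)]; exact norm_ne_zero_iff.2 ht)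
  have h1 := hd.hasDerivAt.comp_hasFDerivAt t (hasStrictFDerivAt_norm_sq t).hasFDerivAt
  have h2 := h1.congr_of_eventuallyEq (f₁ := fun x : F => g / ‖x‖)
    (.of_forall fun x => by simp [Real.sqrt_sq (norm_nonneg x)])
  refine ⟨_, ?_, (hasFDerivAt_id t).sub (h2.smul (hasFDerivAt_id t))⟩
  intro x y
  simp only [ContinuousLinearMap.coe_coe, sub_apply, add_apply, smul_apply,
    ContinuousLinearMap.smulRight_apply, ContinuousLinearMap.id_apply, innerSL_apply_apply,
    inner_sub_left, inner_sub_right, inner_add_left, inner_add_right, real_inner_smul_left,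
    real_inner_smul_right, smul_eq_mul, nsmul_eq_mul]
  rw [real_inner_comm x t]
  ring

theorem soft_eventuallyEq_shrink {g : ℝ} {t : F} (h : g < ‖t‖) : soft g =ᶠ[𝓝 t] shrink g := by
  filter_upwards [continuous_norm.continuousAt.eventually (lt_mem_nhds h)] with x hx
  exact soft_of_lt hx

/-- The closed ball, on which `soft g` vanishes, determines derivatives uniquely even at its
boundary points, by convexity and nonempty interior. -/
theorem eq_zero_of_hasFDerivAt_soft {g : ℝ} (hg : 0 < g) {t : F} (h : ‖t‖ ≤ g)
    {D : F →L[ℝ] F} (hD : HasFDerivAt (soft g) D t) : D = 0 := by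
  have hmem : t ∈ Metric.closedBall (0 : F) g := mem_closedBall_zero_iff.2 h
  have hu : UniqueDiffWithinAt ℝ (Metric.closedBall (0 : F) g) t := by
    refine uniqueDiffWithinAt_convex (convex_closedBall 0 g) ?_ (subset_closure hmem)
    exact ⟨0, mem_interior_iff_mem_nhds.2 (Metric.closedBall_mem_nhds _ hg)⟩
  refine hu.eq hD.hasFDerivWithinAt ?_
  exact (hasFDerivWithinAt_const (0 : F) t _).congr
    (fun x hx => soft_of_le (mem_closedBall_zero_iff.1 hx)) (soft_of_le h)

/-- Only the sphere `‖t₀‖ = g` needs care. There both pieces, `0` and `shrink g`, vanish at `t₀`, so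
each satisfies the estimate with its own derivative. -/
theorem isSemismooth_soft {g : ℝ} (hg : 0 ≤ g) (t₀ : F) : IsSemismooth (soft g) t₀ := by
  rw [isSemismooth_iff_eventually]
  intro ε hε
  rcases hg.eq_or_lt with rfl | hg
  · refine .of_forall fun t D hD => ?_
    rw [soft_zero] at hD ⊢
    rw [hD.unique (hasFDerivAt_id t), id, id, ContinuousLinearMap.id_apply, sub_self, norm_zero]
    positivity
  · rcases lt_or_ge ‖t₀‖ g with h₀ | h₀
    · filter_upwards [continuous_norm.continuousAt.eventually (gt_mem_nhds h₀)] with t ht D hD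
      rw [eq_zero_of_hasFDerivAt_soft hg (le_of_lt ht) hD, soft_of_le (le_of_lt ht),
        soft_of_le h₀.le, zero_apply, sub_self, sub_self, norm_zero]
      positivity
    · have hne : t₀ ≠ 0 := norm_pos_iff.1 (hg.trans_le h₀)
      have h₁ : ∀ᶠ t in 𝓝 t₀, ‖t‖ ≤ g → ‖t₀‖ = g := by
        rcases h₀.eq_or_lt with h | h
        · exact .of_forall fun _ _ => h.symm
        · filter_upwards [continuous_norm.continuousAt.eventually (lt_mem_nhds h)] with t ht htg
          exact absurd htg (not_le.2 ht)
      filter_upwards [eventually_norm_sub_fderiv_le (contDiffAt_shrink g hne) hε, h₁]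
        with t ht ht₁ D hD
      rcases le_or_gt ‖t‖ g with htg | htg
      · rw [eq_zero_of_hasFDerivAt_soft hg htg hD, soft_of_le htg, soft_of_le (ht₁ htg).le,
          zero_apply, sub_self, sub_self, norm_zero]
        positivity
      · have h2 := (hD.congr_of_eventuallyEq (soft_eventuallyEq_shrink htg).symm).fderiv
        rw [h2] at ht
        rwa [soft_of_lt htg, soft_of_ge hg h₀]

/-- A point of the closed ball is approached radially from the open ball, where the derivative is
constantly zero; outside the ball, and for `g = 0`, the constant sequence works. -/
theorem exists_hasFDerivAt_soft {g : ℝ} (hg : 0 ≤ g) (t : F) :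
    ∃ (D : F →L[ℝ] F) (ts : ℕ → F), D.toLinearMap.IsSymmetric ∧ Tendsto ts atTop (𝓝 t) ∧
      ∀ k, HasFDerivAt (soft g) D (ts k) := by
  rcases hg.eq_or_lt with rfl | hg
  · refine ⟨.id ℝ F, fun _ => t, fun _ _ => rfl, tendsto_const_nhds, fun _ => ?_⟩
    rw [soft_zero]
    exact hasFDerivAt_id t
  · rcases le_or_gt ‖t‖ g with h | h
    · refine ⟨0, fun k => (1 - 1 / ((k : ℝ) + 1)) • t, fun x y => by simp, ?_, fun k => ?_⟩
      · have h1 := (tendsto_const_nhds (x := (1 : ℝ))).sub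
          (tendsto_one_div_add_atTop_nhds_zero_nat (𝕜 := ℝ))
        simpa using h1.smul_const t
      · have hk : (0 : ℝ) < 1 / ((k : ℝ) + 1) := by positivity
        have hk1 : 1 / ((k : ℝ) + 1) ≤ 1 := by
          rw [div_le_one (by positivity)]
          linarith [Nat.cast_nonneg (α := ℝ) k]
        have hlt : ‖(1 - 1 / ((k : ℝ) + 1)) • t‖ < g := by
          rw [norm_smul, Real.norm_of_nonneg (by linarith)]
          nlinarith [norm_nonneg t]
        refine (hasFDerivAt_const (0 : F) _).congr_of_eventuallyEq ?_
        filter_upwards [continuous_norm.continuousAt.eventually (gt_mem_nhds hlt)] with x hx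
        exact soft_of_le (le_of_lt hx)
    · obtain ⟨D, hD, hder⟩ := exists_hasFDerivAt_shrink g (norm_pos_iff.1 (hg.trans h))
      exact ⟨D, fun _ => t, hD, tendsto_const_nhds,
        fun _ => hder.congr_of_eventuallyEq (soft_eventuallyEq_shrink h)⟩

end Soft

/-! ### Blockwise soft thresholding on orthogonal subspaces -/

section Separable

variable {κ E F : Type*} [Fintype κ] [NormedAddCommGroup E] [InnerProductSpace ℝ E]
  [NormedAddCommGroup F] [InnerProductSpace ℝ F]

/-- The maps `A i` are coordinate maps, with adjoints `B i`, on pairwise orthogonal subspaces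
that are also orthogonal to the range of the orthogonal projection `R`. -/
structure IsOrthogonalSplitting (A : κ → E →L[ℝ] F) (B : κ → F →L[ℝ] E) (R : E →L[ℝ] E) :
    Prop where
  adjoint : ∀ i x f, (inner ℝ (A i x) f : ℝ) = inner ℝ x (B i f)
  apply_same : ∀ i f, A i (B i f) = f
  apply_ne : ∀ i j f, i ≠ j → A i (B j f) = 0
  apply_proj : ∀ i x, A i (R x) = 0
  proj_apply : ∀ i f, R (B i f) = 0
  proj_proj : ∀ x, R (R x) = R x
  proj_symm : ∀ x y, (inner ℝ (R x) y : ℝ) = inner ℝ x (R y)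

/-- Soft thresholding in the subspaces with coordinates `A i`. -/
def softSum (g : κ → ℝ) (A : κ → E →L[ℝ] F) (B : κ → F →L[ℝ] E) (R : E →L[ℝ] E) (x : E) : E :=
  R x + ∑ i, B i (soft (g i) (A i x))

variable {g : κ → ℝ} {A : κ → E →L[ℝ] F} {B : κ → F →L[ℝ] E} {R : E →L[ℝ] E}

namespace IsOrthogonalSplitting

theorem apply_sum (h : IsOrthogonalSplitting A B R) (x : E) (f : κ → F) (i : κ) :
    A i (R x + ∑ j, B j (f j)) = f i := by
  classical
  rw [map_add, h.apply_proj, zero_add, map_sum, Finset.sum_eq_single i, h.apply_same]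
  · exact fun j _ hj => h.apply_ne i j _ hj.symm
  · simp

theorem proj_sum (h : IsOrthogonalSplitting A B R) (x : E) (f : κ → F) :
    R (R x + ∑ j, B j (f j)) = R x := by
  rw [map_add, h.proj_proj, map_sum, Finset.sum_eq_zero fun j _ => h.proj_apply j _, add_zero]

/-- On the domain of `q`, the inner product splits over the blocks and its `R` part vanishes, so the
inequality is a sum of instances of `soft_variational`. -/
theorem sub_softSum_mem_subdifferential (h : IsOrthogonalSplitting A B R) (hg : ∀ i, 0 ≤ g i)
    {q : E → EReal}
    (hq : ∀ x, R x + ∑ i, B i (A i x) = x → q x = ((∑ i, g i * ‖A i x‖ : ℝ) : EReal))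
    (hq' : ∀ x, R x + ∑ i, B i (A i x) ≠ x → q x = ⊤) (w : E) :
    w - softSum g A B R w ∈ subdifferential q (softSum g A B R w) := by
  set z := softSum g A B R w with hz
  have hAz : ∀ i, A i z = soft (g i) (A i w) := fun i => h.apply_sum w _ i
  have hRz : R z = R w := h.proj_sum w _
  have hfeas : R z + ∑ i, B i (A i z) = z := by
    simp only [hAz, hRz]; rfl
  have hqz := hq z hfeas
  refine ⟨by rw [hqz]; exact EReal.coe_ne_bot _, by rw [hqz]; exact EReal.coe_ne_top _,
    fun y => ?_⟩
  by_cases hy : R y + ∑ i, B i (A i y) = y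
  · rw [hqz, hq y hy]
    have hyz : y - z = R (y - z) + ∑ i, B i (A i (y - z)) := by
      conv_lhs => rw [← hy, ← hfeas]
      simp only [map_sub, Finset.sum_sub_distrib]
      abel
    have hin : (inner ℝ (w - z) (y - z) : ℝ) =
        ∑ i, inner ℝ (A i w - soft (g i) (A i w)) (A i y - soft (g i) (A i w)) := by
      conv_lhs => rw [hyz]
      rw [inner_add_right, ← h.proj_symm, map_sub, hRz, sub_self, inner_zero_left, zero_add,
        inner_sum]
      refine Finset.sum_congr rfl fun i _ => ?_
      rw [← h.adjoint, map_sub, map_sub, hAz]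
    rw [← EReal.coe_add, EReal.coe_le_coe_iff, hin, ← Finset.sum_add_distrib]
    refine Finset.sum_le_sum fun i _ => ?_
    rw [hAz]
    exact soft_variational (hg i) _ _
  · rw [hq' y hy]
    exact le_top

/-- The resolvent leaves the `R` component unchanged, so `x` and `x + y` have the same one. -/
theorem proj_snd_eq_zero (h : IsOrthogonalSplitting A B R) {G : E → Set E}
    (hG : IsResolvent G (softSum g A B R)) {z : Pair E} (hz : z ∈ gph G) : R z.snd = 0 := by
  have h1 := congrArg R ((hG.mem_gph_iff z).1 hz)
  rw [softSum, h.proj_sum, map_add] at h1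
  exact left_eq_add.1 h1.symm

theorem hasFDerivAt_softSum {w : E} {D : κ → F →L[ℝ] F}
    (hD : ∀ i, HasFDerivAt (soft (g i)) (D i) (A i w)) :
    HasFDerivAt (softSum g A B R) (R + ∑ i, (B i).comp ((D i).comp (A i))) w := by
  refine R.hasFDerivAt.add (HasFDerivAt.fun_sum fun i _ => ?_)
  exact (B i).hasFDerivAt.comp w ((hD i).comp w (A i).hasFDerivAt)

/-- Restricting the sum to the affine slice `t ↦ w + B i (t - A i w)` and reading off the coordinate
`A i` isolates one block. -/
theorem hasFDerivAt_soft (h : IsOrthogonalSplitting A B R) {w : E} {D : E →L[ℝ] E}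
    (hD : HasFDerivAt (softSum g A B R) D w) (i : κ) :
    HasFDerivAt (soft (g i)) ((A i).comp (D.comp (B i))) (A i w) := by
  have h1 : HasFDerivAt (fun t : F => w + B i (t - A i w)) (B i) (A i w) :=
    (((B i).hasFDerivAt).comp (A i w) ((hasFDerivAt_id (A i w)).sub_const (A i w))).const_add w
  have h2 : HasFDerivAt (softSum g A B R) D (w + B i (A i w - A i w)) := by
    rwa [sub_self, map_zero, add_zero]
  have h3 := (A i).hasFDerivAt.comp (A i w) (h2.comp (A i w) h1)
  refine h3.congr_of_eventuallyEq (.of_forall fun t => ?_)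
  simp only [Function.comp_apply]
  rw [softSum, h.apply_sum, map_add, h.apply_same, add_sub_cancel]

/-- Differentiability of the sum passes to each block, and uniqueness of the derivative forces `D`
into block form; the residual is then the sum of the block residuals. -/
theorem isSemismooth_softSum (h : IsOrthogonalSplitting A B R) (hg : ∀ i, 0 ≤ g i) (w₀ : E) :
    IsSemismooth (softSum g A B R) w₀ := by
  rw [isSemismooth_iff_eventually]
  intro ε hε
  -- The summand 1 keeps `C` positive when there are no blocks.
  set C : ℝ := ∑ i, ‖B i‖ * ‖A i‖ + 1 with hC
  have hC0 : 0 ≤ ∑ i, ‖B i‖ * ‖A i‖ := Finset.sum_nonneg fun i _ => by positivity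
  have hCpos : 0 < C := by linarith
  have hev : ∀ᶠ w in 𝓝 w₀, ∀ i, ∀ D : F →L[ℝ] F, HasFDerivAt (soft (g i)) D (A i w) →
      ‖soft (g i) (A i w) - soft (g i) (A i w₀) - D (A i w - A i w₀)‖ ≤
        ε / C * ‖A i w - A i w₀‖ := by
    rw [eventually_all]
    intro i
    exact ((A i).continuous.tendsto w₀).eventually
      (isSemismooth_iff_eventually.1 (isSemismooth_soft (hg i) (A i w₀)) (ε / C) (by positivity))
  filter_upwards [hev] with w hw D hD
  have hDi := fun i => h.hasFDerivAt_soft hD i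
  have hDeq := hD.unique (hasFDerivAt_softSum (B := B) (R := R) hDi)
  set Di : κ → F →L[ℝ] F := fun i => (A i).comp (D.comp (B i)) with hDidef
  have hid : softSum g A B R w - softSum g A B R w₀ - D (w - w₀) =
      ∑ i, B i (soft (g i) (A i w) - soft (g i) (A i w₀) - Di i (A i w - A i w₀)) := by
    have hDw : D (w - w₀) = R (w - w₀) + ∑ i, B i (Di i (A i (w - w₀))) := by
      conv_lhs => rw [hDeq]
      simp only [add_apply, sum_apply, ContinuousLinearMap.comp_apply, hDidef]
    rw [hDw]
    simp only [softSum, map_sub, Finset.sum_sub_distrib]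
    abel
  rw [hid]
  calc _ ≤ ∑ i, ‖B i‖ * (ε / C * (‖A i‖ * ‖w - w₀‖)) := by
        refine norm_sum_le_of_le _ fun i _ => ((B i).le_opNorm _).trans ?_
        gcongr
        refine (hw i _ (hDi i)).trans ?_
        gcongr
        rw [← map_sub]
        exact (A i).le_opNorm _
    _ = ε / C * ((∑ i, ‖B i‖ * ‖A i‖) * ‖w - w₀‖) := by
        rw [Finset.sum_mul, Finset.mul_sum]
        exact Finset.sum_congr rfl fun i _ => by ring
    _ ≤ ε / C * (C * ‖w - w₀‖) := by
        gcongr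
        linarith
    _ = ε * ‖w - w₀‖ := by field_simp

theorem exists_hasFDerivAt_softSum (h : IsOrthogonalSplitting A B R) (hg : ∀ i, 0 ≤ g i) (w : E) :
    ∃ (D : E →L[ℝ] E) (ws : ℕ → E), D.toLinearMap.IsSymmetric ∧ Tendsto ws atTop (𝓝 w) ∧
      ∀ k, HasFDerivAt (softSum g A B R) D (ws k) := by
  classical
  choose D ts hD hts hder using fun i => exists_hasFDerivAt_soft (hg i) (A i w)
  refine ⟨R + ∑ i, (B i).comp ((D i).comp (A i)),
    fun k => w + ∑ i, B i (ts i k - A i w), ?_, ?_, fun k => hasFDerivAt_softSum fun i => ?_⟩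
  · intro x y
    simp only [ContinuousLinearMap.coe_coe, add_apply, sum_apply,
      ContinuousLinearMap.comp_apply, inner_add_left, inner_add_right, inner_sum, sum_inner]
    rw [h.proj_symm]
    congr 1
    refine Finset.sum_congr rfl fun i _ => ?_
    have h1 : (inner ℝ (D i (A i x)) (A i y) : ℝ) = inner ℝ (A i x) (D i (A i y)) := hD i _ _
    rw [← h.adjoint, ← h1, real_inner_comm, ← h.adjoint, real_inner_comm]
  · have h1 : Tendsto (fun k => ∑ i, B i (ts i k - A i w)) atTop
        (𝓝 (∑ i, B i (A i w - A i w))) :=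
      tendsto_finsetSum _ fun i _ =>
        ((B i).continuous.tendsto _).comp ((hts i).sub_const _)
    simpa using h1.const_add w
  · have e : A i (w + ∑ j, B j (ts j k - A j w)) = ts i k := by
      have h1 := h.apply_sum 0 (fun j => ts j k - A j w) i
      rw [map_zero, zero_add] at h1
      rw [map_add, h1, add_sub_cancel]
    rw [e]
    exact hder i k

end IsOrthogonalSplitting

end Separable

/-! ### Uniform regularity from monotonicity -/

section Regularity

variable {E : Type*} [NormedAddCommGroup E] [InnerProductSpace ℝ E] [FiniteDimensional ℝ E]

/-- The elements `(a, b)` of the subspaces in the SC derivative of `∂q` satisfy `⟨a, b⟩ ≥ 0` and,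
if `R` annihilates all subgradients, `R b = 0`. This yields a uniform regularity estimate. -/
theorem exists_regularity_constant {q : E → EReal} {m : E →ₗ[ℝ] E}
    {R : E →L[ℝ] E}
    (hRsymm : ∀ x y, (inner ℝ (R x) y : ℝ) = inner ℝ x (R y))
    (hR : ∀ z ∈ gph (subdifferential q), R z.snd = 0)
    (hM : ∀ a b, 0 ≤ (inner ℝ a b : ℝ) → R b = 0 → m a + b = 0 → a = 0) :
    ∃ c : ℝ, 0 < c ∧ ∀ z, ∀ L ∈ scDeriv (subdifferential q) z, ∀ v ∈ L,
      c * ‖v‖ ≤ ‖m v.fst + v.snd‖ := by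
  set K : Set (Pair E) :=
    {v | 0 ≤ (inner ℝ v.fst v.snd : ℝ)} ∩ {v | R v.snd = 0} with hK
  have hKc : IsClosed K :=
    (isClosed_le continuous_const (continuous_pair_fst.inner continuous_pair_snd)).inter
      (isClosed_eq (R.continuous.comp continuous_pair_snd) continuous_const)
  have htan : ∀ z ∈ gph (subdifferential q), tangentCone (gph (subdifferential q)) z ⊆ K := by
    intro z hz v hv
    refine ⟨inner_nonneg_of_mem_tangentCone hz hv, ?_⟩
    refine ext_inner_left ℝ fun y => ?_
    rw [← hRsymm, inner_zero_right]
    refine inner_eq_zero_of_mem_tangentCone (fun w hw => ?_) hz hv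
    rw [hRsymm, hR w hw, inner_zero_right]
  let T₀ : Pair E →ₗ[ℝ] E :=
    { toFun := fun v => m v.fst + v.snd
      map_add' := fun v w => by
        rw [WithLp.add_fst, WithLp.add_snd, map_add]; abel
      map_smul' := fun r v => by
        rw [WithLp.smul_fst, WithLp.smul_snd, map_smul, smul_add, RingHom.id_apply] }
  obtain ⟨c, hc, hbound⟩ := exists_lower_bound_of_isClosed_cone hKc
    (fun r hr v hv => by
      refine ⟨?_, ?_⟩
      · have := hv.1
        simp only [Set.mem_ofPred_eq, WithLp.smul_fst, WithLp.smul_snd, real_inner_smul_left,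
          real_inner_smul_right] at this ⊢
        positivity
      · have h2 : R v.snd = 0 := hv.2
        simp only [Set.mem_ofPred_eq, WithLp.smul_snd, map_smul, h2, smul_zero])
    (LinearMap.toContinuousLinearMap T₀) (fun v hv hv0 => by
      have h0 : m v.fst + v.snd = 0 := hv0
      have h1 := hM v.fst v.snd hv.1 hv.2 h0
      have h2 : v.snd = 0 := by rwa [h1, map_zero, zero_add] at h0
      rw [← norm_le_zero_iff]
      have := norm_le_norm_fst_add_norm_snd v
      rwa [h1, h2, norm_zero, add_zero] at this)
  exact ⟨c, hc, fun z L hL v hv => hbound v (subset_of_mem_scDeriv hKc htan hL hv)⟩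

end Regularity

end SCD

/-! ### The discretized Stokes problem -/

namespace Stokes

namespace Data

variable {nS nI nP : ℕ}

/-- The map `x ↦ M u^i` for a matrix `M` with three columns. -/
def nodeMap (M : Matrix (Fin 2) (Fin 3) ℝ) (i : Fin nS) :
    State nS nI nP →L[ℝ] EuclideanSpace ℝ (Fin 2) :=
  LinearMap.toContinuousLinearMap
    { toFun := fun x => WithLp.toLp 2 (M.mulVec (slipVelocity x i))
      map_add' := fun x y => by
        change WithLp.toLp 2 (M.mulVec (slipVelocity x i + slipVelocity y i)) = _
        rw [Matrix.mulVec_add]; rfl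
      map_smul' := fun r x => by
        change WithLp.toLp 2 (M.mulVec (r • slipVelocity x i)) = _
        rw [Matrix.mulVec_smul]; rfl }

theorem nodeMap_apply (M : Matrix (Fin 2) (Fin 3) ℝ) (i : Fin nS) (x : State nS nI nP) :
    nodeMap M i x = WithLp.toLp 2 (M.mulVec (slipVelocity x i)) := rfl

/-- The vector with velocities `v i` at the nodes of the stick-slip boundary and zero elsewhere. -/
def slipEmbed (v : Fin nS → Fin 3 → ℝ) : State nS nI nP :=
  WithLp.toLp 2 (Sum.elim (fun k => Sum.elim (fun i => v i k.2) (fun _ => 0) k.1) (fun _ => 0))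

theorem slipVelocity_slipEmbed (v : Fin nS → Fin 3 → ℝ) (i : Fin nS) :
    slipVelocity (slipEmbed v : State nS nI nP) i = v i := rfl

theorem slipEmbed_add (v w : Fin nS → Fin 3 → ℝ) :
    (slipEmbed (v + w) : State nS nI nP) = slipEmbed v + slipEmbed w := by
  ext ((⟨i | i, j⟩) | k) <;> simp [slipEmbed]

theorem slipEmbed_smul (r : ℝ) (v : Fin nS → Fin 3 → ℝ) :
    (slipEmbed (r • v) : State nS nI nP) = r • slipEmbed v := by
  ext ((⟨i | i, j⟩) | k) <;> simp [slipEmbed]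

theorem slipEmbed_single_sum (v : Fin nS → Fin 3 → ℝ) :
    ∑ i, (slipEmbed (Pi.single i (v i)) : State nS nI nP) = slipEmbed v := by
  let S : (Fin nS → Fin 3 → ℝ) →+ State nS nI nP :=
    { toFun := slipEmbed
      map_zero' := by ext ((⟨i | i, j⟩) | k) <;> simp [slipEmbed]
      map_add' := slipEmbed_add }
  have h := map_sum S (fun i => Pi.single i (v i)) Finset.univ
  rw [Finset.univ_sum_single] at h
  exact h.symm

theorem inner_slipEmbed (x : State nS nI nP) (v : Fin nS → Fin 3 → ℝ) :
    (inner ℝ x (slipEmbed v) : ℝ) = ∑ i, slipVelocity x i ⬝ᵥ v i := by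
  simp [EuclideanSpace.inner_eq_star_dotProduct, slipEmbed, slipVelocity, dotProduct,
    Fintype.sum_prod_type, mul_comm]

/-- The adjoint of `nodeMap`. -/
def nodeAdjoint (M : Matrix (Fin 2) (Fin 3) ℝ) (i : Fin nS) :
    EuclideanSpace ℝ (Fin 2) →L[ℝ] State nS nI nP :=
  LinearMap.toContinuousLinearMap
    { toFun := fun f => slipEmbed (Pi.single i (M.transpose.mulVec f.ofLp))
      map_add' := fun x y => by
        rw [← slipEmbed_add, ← Pi.single_add, ← Matrix.mulVec_add]; rfl
      map_smul' := fun r x => by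
        rw [RingHom.id_apply, ← slipEmbed_smul, ← Pi.single_smul, ← Matrix.mulVec_smul]; rfl }

theorem nodeAdjoint_apply (M : Matrix (Fin 2) (Fin 3) ℝ) (i : Fin nS)
    (f : EuclideanSpace ℝ (Fin 2)) :
    (nodeAdjoint M i f : State nS nI nP) =
      slipEmbed (Pi.single i (M.transpose.mulVec f.ofLp)) := rfl

/-- The projection that sets the velocities at the stick-slip boundary to zero. -/
def offSlip : State nS nI nP →L[ℝ] State nS nI nP :=
  LinearMap.toContinuousLinearMap
    { toFun := fun x => x - slipEmbed (slipVelocity x)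
      map_add' := fun x y => by
        rw [show slipVelocity (x + y) = slipVelocity x + slipVelocity y from rfl, slipEmbed_add]
        abel
      map_smul' := fun r x => by
        rw [show slipVelocity (r • x) = r • slipVelocity x from rfl, slipEmbed_smul, smul_sub,
          RingHom.id_apply] }

theorem offSlip_apply (x : State nS nI nP) : offSlip x = x - slipEmbed (slipVelocity x) := rfl

theorem slipVelocity_offSlip (x : State nS nI nP) (i : Fin nS) :
    slipVelocity (offSlip x) i = 0 := by
  ext j
  exact sub_self _

theorem offSlip_slipEmbed (v : Fin nS → Fin 3 → ℝ) :
    offSlip (slipEmbed v : State nS nI nP) = 0 :=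
  sub_self _

variable (D : Data nS nI nP)

theorem T_mul_transpose {i : Fin nS} (hQ : D.Q i * (D.Q i).transpose = 1) :
    D.T i * (D.T i).transpose = 1 ∧ D.N i * (D.T i).transpose = 0 := by
  rw [Q, Matrix.transpose_fromRows, Matrix.fromRows_mul_fromCols, ← Matrix.fromBlocks_one,
    Matrix.fromBlocks_inj] at hQ
  exact ⟨hQ.1, hQ.2.2.1⟩

theorem transpose_mul_T_add {i : Fin nS} (hQ : (D.Q i).transpose * D.Q i = 1) :
    (D.T i).transpose * D.T i + (D.N i).transpose * D.N i = 1 := by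
  rwa [Q, Matrix.transpose_fromRows, Matrix.fromCols_mul_fromRows] at hQ

theorem isOrthogonalSplitting
    (hQ : ∀ i, D.Q i * (D.Q i).transpose = 1 ∧ (D.Q i).transpose * D.Q i = 1) :
    SCD.IsOrthogonalSplitting (fun i => nodeMap (nI := nI) (nP := nP) (D.T i) i)
      (fun i => nodeAdjoint (D.T i) i) offSlip where
  adjoint i x f := by
    rw [nodeMap_apply, nodeAdjoint_apply, inner_slipEmbed, Finset.sum_eq_single i]
    · rw [Pi.single_eq_same, Matrix.mulVec_transpose, EuclideanSpace.inner_eq_star_dotProduct,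
        star_trivial, Matrix.dotProduct_mulVec, dotProduct_comm]
    · intro j _ hj
      rw [Pi.single_eq_of_ne hj, dotProduct_zero]
    · simp
  apply_same i f := by
    rw [nodeMap_apply, nodeAdjoint_apply, slipVelocity_slipEmbed, Pi.single_eq_same,
      Matrix.mulVec_mulVec, (D.T_mul_transpose (hQ i).1).1, Matrix.one_mulVec]
  apply_ne i j f hij := by
    rw [nodeMap_apply, nodeAdjoint_apply, slipVelocity_slipEmbed, Pi.single_eq_of_ne hij,
      Matrix.mulVec_zero, WithLp.toLp_zero]
  apply_proj i x := by
    rw [nodeMap_apply, slipVelocity_offSlip, Matrix.mulVec_zero, WithLp.toLp_zero]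
  proj_apply i f := offSlip_slipEmbed _
  proj_proj x := by
    conv_lhs => rw [offSlip_apply x]
    rw [map_sub, offSlip_slipEmbed, sub_zero]
  proj_symm x y := by
    rw [offSlip_apply, offSlip_apply, inner_sub_left, inner_sub_right, inner_slipEmbed,
      real_inner_comm y (slipEmbed _), inner_slipEmbed]
    congr 1
    exact Finset.sum_congr rfl fun i _ => dotProduct_comm _ _

/-- The feasible velocities are those without normal components at the stick-slip boundary. -/
theorem feasible_iff (hQ : ∀ i, D.Q i * (D.Q i).transpose = 1 ∧ (D.Q i).transpose * D.Q i = 1)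
    (x : State nS nI nP) :
    offSlip x + ∑ i, nodeAdjoint (D.T i) i (nodeMap (D.T i) i x) = x ↔
      ∀ i, (D.N i).mulVec (slipVelocity x i) = 0 := by
  have hsum : ∑ i, (nodeAdjoint (D.T i) i (nodeMap (D.T i) i x) : State nS nI nP) =
      slipEmbed fun i => (D.T i).transpose.mulVec ((D.T i).mulVec (slipVelocity x i)) := by
    simp only [nodeAdjoint_apply, nodeMap_apply]
    exact slipEmbed_single_sum fun i => (D.T i).transpose.mulVec ((D.T i).mulVec (slipVelocity x i))
  rw [hsum, offSlip_apply]
  constructor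
  · intro h i
    have h1 : slipVelocity x i = (D.T i).transpose.mulVec ((D.T i).mulVec (slipVelocity x i)) := by
      have h2 : slipEmbed (slipVelocity x) = slipEmbed (nI := nI) (nP := nP)
          fun i => (D.T i).transpose.mulVec ((D.T i).mulVec (slipVelocity x i)) := by
        rw [sub_add_eq_add_sub, sub_eq_iff_eq_add] at h
        exact (add_left_cancel h).symm
      have h3 := congrArg (fun y => slipVelocity y i) h2
      exact h3
    rw [h1, Matrix.mulVec_mulVec, (D.T_mul_transpose (hQ i).1).2, Matrix.zero_mulVec]
  · intro h
    have h1 : (fun i => (D.T i).transpose.mulVec ((D.T i).mulVec (slipVelocity x i))) =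
        slipVelocity x := by
      ext1 i
      have h2 := congrArg (fun X => X.mulVec (slipVelocity x i)) (D.transpose_mul_T_add (hQ i).2)
      simp only [Matrix.add_mulVec, Matrix.one_mulVec, ← Matrix.mulVec_mulVec, h i,
        Matrix.mulVec_zero, add_zero] at h2
      exact h2
    rw [h1, sub_add_cancel]

theorem q_eq_coe {x : State nS nI nP} (h : ∀ i, (D.N i).mulVec (slipVelocity x i) = 0) :
    D.q x = ((∑ i, D.g i * ‖nodeMap (D.T i) i x‖ : ℝ) : EReal) := by
  have hcoe : ∀ s : Finset (Fin nS), ∀ f : Fin nS → ℝ,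
      ((∑ i ∈ s, f i : ℝ) : EReal) = ∑ i ∈ s, (f i : EReal) := fun s f => by
    classical
    induction s using Finset.induction_on with
    | empty => simp
    | insert a s ha ih => rw [Finset.sum_insert ha, Finset.sum_insert ha, EReal.coe_add, ih]
  rw [hcoe, q]
  refine Finset.sum_congr rfl fun i _ => ?_
  rw [qNode, if_pos (h i), add_zero, nodeMap_apply]

/-- Nonnegative slip bounds keep the other summands away from `⊥`, which would absorb `⊤`. -/
theorem q_eq_top (hg : ∀ i, 0 ≤ D.g i) {x : State nS nI nP} {i : Fin nS}
    (h : (D.N i).mulVec (slipVelocity x i) ≠ 0) : D.q x = ⊤ := by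
  have hnonneg : ∀ j, 0 ≤ D.qNode j (slipVelocity x j) := fun j => by
    refine add_nonneg (EReal.coe_nonneg.2 (mul_nonneg (hg j) (norm_nonneg _))) ?_
    split_ifs
    · exact le_rfl
    · exact le_top
  rw [q, ← Finset.add_sum_erase _ _ (Finset.mem_univ i)]
  have h1 : D.qNode i (slipVelocity x i) = ⊤ := by
    rw [qNode, if_neg h, EReal.coe_add_top]
  rw [h1]
  exact EReal.top_add_of_ne_bot
    (ne_bot_of_le_ne_bot (by simp) (Finset.sum_nonneg fun j _ => hnonneg j))

/-- The resolvent of `lam ∂q` is blockwise soft thresholding. -/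
theorem sub_softSum_mem_subdifferential
    (hQ : ∀ i, D.Q i * (D.Q i).transpose = 1 ∧ (D.Q i).transpose * D.Q i = 1)
    (hg : ∀ i, 0 ≤ D.g i) {lam : ℝ} (hlam : 0 < lam) (w : State nS nI nP) :
    w - SCD.softSum (fun i => lam * D.g i) (fun i => nodeMap (D.T i) i)
        (fun i => nodeAdjoint (D.T i) i) offSlip w ∈
      SCD.subdifferential (fun y => (lam : EReal) * D.q y)
        (SCD.softSum (fun i => lam * D.g i) (fun i => nodeMap (D.T i) i)
          (fun i => nodeAdjoint (D.T i) i) offSlip w) := by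
  refine (D.isOrthogonalSplitting hQ).sub_softSum_mem_subdifferential
    (fun i => mul_nonneg hlam.le (hg i)) (fun x hx => ?_) (fun x hx => ?_) w
  · rw [D.q_eq_coe ((D.feasible_iff hQ x).1 hx), ← EReal.coe_mul, Finset.mul_sum]
    simp only [mul_assoc]
  · rw [ne_eq, D.feasible_iff hQ x, not_forall] at hx
    obtain ⟨i, hi⟩ := hx
    rw [D.q_eq_top hg hi, EReal.coe_mul_top_of_pos hlam]

theorem isResolvent
    (hQ : ∀ i, D.Q i * (D.Q i).transpose = 1 ∧ (D.Q i).transpose * D.Q i = 1)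
    (hg : ∀ i, 0 ≤ D.g i) :
    SCD.IsResolvent (SCD.subdifferential D.q)
      (SCD.softSum D.g (fun i => nodeMap (D.T i) i) (fun i => nodeAdjoint (D.T i) i) offSlip) := by
  refine SCD.isResolvent_subdifferential fun w => ?_
  simpa only [one_mul, EReal.coe_one] using D.sub_softSum_mem_subdifferential hQ hg one_pos w

/-- The matrix of the affine mapping `H`. -/
def stokesMatrix : Matrix (Idx nS nI nP) (Idx nS nI nP) ℝ :=
  Matrix.fromBlocks D.A (-D.B.transpose) D.B D.E

theorem H_apply (x : State nS nI nP) :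
    D.H x = D.stokesMatrix.toEuclideanLin x - WithLp.toLp 2 (Sum.elim D.b D.c) := rfl

theorem eq_zero_of_noSlipMatrix_mulVec (hNoSlip : ∃! y, D.noSlipMatrix.mulVec y = D.noSlipRhs)
    {y : (Fin nI × Fin 3) ⊕ Fin nP → ℝ} (hy : D.noSlipMatrix.mulVec y = 0) : y = 0 := by
  obtain ⟨y₀, hy₀, huniq⟩ := hNoSlip
  have h := huniq (y₀ + y) (by
    dsimp only at hy₀ ⊢
    rw [Matrix.mulVec_add, hy₀, hy, add_zero])
  exact left_eq_add.1 h.symm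

/-- Testing the equation with `a = (u, p)` cancels the skew blocks `B` and `-Bᵀ`, leaving `uᵀ A u +
pᵀ E p ≤ 0`. Hence `u = 0`; the rows not erased by `offSlip b = 0` then place `(0, p)` in the kernel
of the no-slip matrix. -/
theorem eq_zero_of_transpose_add_eq_zero (hA : D.A.PosDef) (hE : D.E.PosSemidef)
    (hNoSlip : ∃! y, D.noSlipMatrix.mulVec y = D.noSlipRhs) {a b : State nS nI nP}
    (hab : 0 ≤ (inner ℝ a b : ℝ)) (hb : offSlip b = 0)
    (h : D.stokesMatrix.transpose.toEuclideanLin a + b = 0) : a = 0 := by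
  obtain ⟨u, p, rfl⟩ : ∃ u p, a = WithLp.toLp 2 (Sum.elim u p) :=
    ⟨fun k => a (Sum.inl k), fun k => a (Sum.inr k), by ext (k | k) <;> rfl⟩
  have hEt : D.E.transpose = D.E := by
    rw [← Matrix.conjTranspose_eq_transpose_of_trivial]; exact hE.1
  have hAt : D.A.transpose = D.A := by
    rw [← Matrix.conjTranspose_eq_transpose_of_trivial]; exact hA.1
  have hbeq : b = -WithLp.toLp 2 (Sum.elim (D.A.mulVec u + D.B.transpose.mulVec p)
      (-(D.B.mulVec u) + D.E.mulVec p)) := by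
    rw [eq_neg_of_add_eq_zero_right h, Matrix.toLpLin_toLp, Matrix.toLin'_apply, stokesMatrix,
      Matrix.fromBlocks_transpose, Matrix.fromBlocks_mulVec, hEt, hAt, Matrix.transpose_neg,
      Matrix.transpose_transpose, Matrix.neg_mulVec]
    rfl
  have hsum : u ⬝ᵥ D.A.mulVec u + p ⬝ᵥ D.E.mulVec p ≤ 0 := by
    rw [hbeq, inner_neg_right, EuclideanSpace.inner_eq_star_dotProduct] at hab
    simp only [star_trivial, sumElim_dotProduct_sumElim, add_dotProduct,
      neg_dotProduct] at hab
    have h1 : D.B.transpose.mulVec p ⬝ᵥ u = D.B.mulVec u ⬝ᵥ p := by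
      rw [Matrix.mulVec_transpose, ← Matrix.dotProduct_mulVec, dotProduct_comm]
    rw [dotProduct_comm u, dotProduct_comm p]
    linarith
  have hpE : 0 ≤ p ⬝ᵥ D.E.mulVec p := by simpa using hE.dotProduct_mulVec_nonneg p
  have hu : u = 0 := by
    by_contra hu
    have := hA.dotProduct_mulVec_pos hu
    rw [star_trivial] at this
    linarith
  subst hu
  rw [Matrix.mulVec_zero, Matrix.mulVec_zero, zero_add, neg_zero, zero_add] at hbeq
  have hcoord : ∀ k, (offSlip b) k = 0 := fun k => by rw [hb]; rfl
  have h1 : D.E.mulVec p = 0 := by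
    ext k
    have := hcoord (Sum.inr k)
    rw [offSlip_apply, hbeq] at this
    simpa [slipEmbed] using this
  have h2 : ∀ k, D.B.transpose.mulVec p (incl k) = 0 := fun k => by
    have := hcoord (Sum.inl (incl k))
    rw [offSlip_apply, hbeq] at this
    simpa [slipEmbed, incl] using this
  have h3 : D.noSlipMatrix.mulVec (Sum.elim 0 p) = 0 := by
    rw [noSlipMatrix, Matrix.fromBlocks_mulVec, Sum.elim_comp_inl, Sum.elim_comp_inr,
      Matrix.mulVec_zero, Matrix.mulVec_zero, zero_add, zero_add, h1, Matrix.neg_mulVec]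
    ext (k | k)
    · have := h2 k
      simp only [Sum.elim_inl, Pi.neg_apply, Pi.zero_apply, neg_eq_zero]
      exact this
    · rfl
  have h4 := D.eq_zero_of_noSlipMatrix_mulVec hNoSlip h3
  have hp : p = 0 := by
    ext k
    exact congrFun h4 (Sum.inr k)
  rw [hp, Sum.elim_zero_zero, WithLp.toLp_zero]

end Data

end Stokes

end

theorem mainTheorem1 {nS nI nP : ℕ} (D : Stokes.Data nS nI nP)
    (hA : D.A.PosDef) (hE : D.E.PosSemidef)
    (hQ : ∀ i, D.Q i * (D.Q i).transpose = 1 ∧ (D.Q i).transpose * D.Q i = 1)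
    (hg : ∀ i, 0 ≤ D.g i)
    (hNoSlip : ∃! y, D.noSlipMatrix.mulVec y = D.noSlipRhs)
    (xbar : Stokes.State nS nI nP) (hx : SCD.IsSolution D.H D.q xbar) :
    (∀ z ∈ SCD.gph (SCD.subdifferential D.q),
      SCD.IsSCDSemismooth (SCD.subdifferential D.q) z) ∧
    (∀ P W : Matrix (Stokes.Idx nS nI nP) (Stokes.Idx nS nI nP) ℝ,
      (P, W) ∈ SCD.matPW (SCD.subdifferential D.q) (SCD.pair xbar (-D.H xbar)) →
        IsUnit (P * SCD.jacobian D.H xbar * P + W)) ∧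
    (∀ lam : ℝ, 0 < lam → SCD.NewtonConvergesLocally D.H D.q lam xbar) := by
  have hsplit := D.isOrthogonalSplitting hQ
  have hres := D.isResolvent hQ hg
  have hlip := SCD.lipschitzWith_resolvent hres
  have hne := fun z (hz : z ∈ SCD.gph (SCD.subdifferential D.q)) =>
    SCD.scDeriv_nonempty_and_matPW_nonempty hres hlip.continuous
      (hsplit.exists_hasFDerivAt_softSum hg) hz
  have hss : ∀ z ∈ SCD.gph (SCD.subdifferential D.q),
      SCD.IsSCDSemismooth (SCD.subdifferential D.q) z := fun z hz =>
    (hsplit.isSemismooth_softSum hg _).isSCDSemismooth hres hlip (fun z hz => (hne z hz).1) hz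
  obtain ⟨c, hc, hreg⟩ := SCD.exists_regularity_constant (q := D.q)
    (m := D.stokesMatrix.transpose.toEuclideanLin) hsplit.proj_symm
    (fun z hz => hsplit.proj_snd_eq_zero hres hz)
    (fun a b => D.eq_zero_of_transpose_add_eq_zero hA hE hNoSlip)
  have hbar : SCD.pair xbar (-D.H xbar) ∈ SCD.gph (SCD.subdifferential D.q) := by
    obtain ⟨v, hv, hv0⟩ := hx
    rw [← eq_neg_of_add_eq_zero_right hv0]
    exact hv
  refine ⟨hss, fun P W hPW => ?_, fun lam hlam => ?_⟩
  · rw [SCD.jacobian_of_affine D.H_apply]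
    exact SCD.isUnit_newton hc hreg hPW
  · exact SCD.newtonConvergesLocally_of_affine D.H_apply hlam
      (fun x => ⟨_, D.sub_softSum_mem_subdifferential hQ hg hlam x⟩) (fun z hz => (hne z hz).2) hc
      hreg (hss _ hbar)
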